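/- Let $\delta>0$ and $M\in\mathbb{R}$ be fixed. Consider periodic travelling waves $u(x,t)=U(k(x-ct))$ of the generalized Kuramoto--Sivashinsky equation $\partial_t u+6u\,\partial_xu+\partial_x^3u+\delta(\partial_x^2u+\partial_x^4u)=0$, with wavenumber $k$ and $2\pi$-periodic profile $U$. Write $\langle f\rangle=\frac1{2\pi}\int_0^{2\pi}f$. There exist $k_0\in(0,1)$ and $C$, depending only on $\delta$ and $M$, such that for every $k\in(k_0,1)$ the following holds. There are a unique $c=c(k,M)\in\mathbb{R}$ and a unique $\overline q=\overline q(k,M)\in\mathbb{R}$ for which the integrated profile equation $$k\,(3U^2-cU)+k^3U''+\delta\,(k^2U'+k^4U''')=\overline q,\qquad \langle U\rangle=M,$$ has a nonconstant $2\pi$-periodic $C^3$ solution $U=U(\cdot\,;k,M)$, and this solution is unique up to translation: every nonconstant $2\pi$-periodic $C^3$ function that solves this problem for some real $c$ and $\overline q$ does so with $c=c(k,M)$, $\overline q=\overline q(k,M)$, and is of the form $y\mapsto U(y+s;k,M)$ with $s\in\mathbb{R}$. Moreover these wave trains have small amplitude and emanate, as $k\to1^-$, from the Hopf bifurcation point $U=M$,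 $c=6M-1$, $\overline q=3M^2-cM=M-3M^2$: $$\sup_{y}|U(y;k,M)-M|\le C\sqrt{1-k},\quad |c(k,M)-(6M-1)|\le C(1-k),\quad |\overline q(k,M)-(M-3M^2)|\le C(1-k).$$ -/

import Mathlib

/-- The average `⟨f⟩` of a `2π`-periodic function over one period. -/
noncomputable def periodMean (f : ℝ → ℝ) : ℝ :=
  (2 * Real.pi)⁻¹ * ∫ y in (0 : ℝ)..(2 * Real.pi), f y

/-- `U` is the profile, as a function of the phase `y = k (x - c t)`, of a periodic wave train of
(gKS) with wavenumber `k`, mean `M`, speed `c` and integration constant `q`: a nonconstant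
classical `2π`-periodic solution of the integrated profile equation with mean `M`. -/
structure IsWaveTrain (δ k M c q : ℝ) (U : ℝ → ℝ) : Prop where
  contDiff : ContDiff ℝ 3 U
  periodic : Function.Periodic U (2 * Real.pi)
  nonconstant : ∃ x y, U x ≠ U y
  profile_eq : ∀ y, k * (3 * U y ^ 2 - c * U y) + k ^ 3 * iteratedDeriv 2 U y
    + δ * (k ^ 2 * deriv U y + k ^ 4 * iteratedDeriv 3 U y) = q
  mean_eq : periodMean U = M

open Real MeasureTheory ComplexConjugate
open Complex (I)

namespace WaveTrain

/-! Write `U = M + x` with `x` of mean zero, `a = 6M - c` and `ε² = 1 - k²`. After division by `k`,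
the nonzero Fourier modes satisfy `symbol δ k a n · x_n + 3 (x²)_n = 0`; the zero mode only fixes
`q`. The symbol at `n = ±1` is `a - k² ± iδkε²`, which degenerates at the Hopf point, while near
that point it is boundedly invertible on `|n| ≥ 2`.

Existence is a Lyapunov–Schmidt reduction. Put `x = A (e^{iy} + e^{-iy}) + A² z`, `A = ε√β`, `a = k²
+ ε² b`. Mode 1 divided by `ε² A` reads `b + iδk + 6β z_2 + O(ε) = 0`, and the modes `|n| ≥ 2` give
`z` up to `O(ε)`. The real part of mode 1 yields `b`, the imaginary part yields `β`; the leading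
value of `β` is positive because the inverse symbol at `n = 2` has positive imaginary part
(`invSymbol_two_im_lower`). So `(β, z)` is a fixed point of `leading + ε · correction`, a
contraction on any sufficiently large region once `ε` is small (`exists_unique_fixed`). Elliptic
regularity turns it into a classical wave (`SolvesModes.isWaveTrain`).

Uniqueness must cover waves of arbitrary size. Pairing the equation with `x'` leaves the energy
balance `∑ n² (k² n² - 1) |x_n|² = 0`, where only `n = ±1` has negative weight, namely `-ε²`. Hence
a nonconstant wave has `A = |x_1| > 0` and its higher modes are `O(εA)`. Modes 1 and 2 then force
`A` to be comparable to `ε` and the higher part to be `O(A²)` (`exists_scaledModes`). After a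
translation every wave therefore lies in the region of the contraction and is its fixed point. -/

instance fact_two_pi_pos : Fact (0 < 2 * π) := ⟨Real.two_pi_pos⟩

/-! ### Fourier coefficients and multipliers on the circle. -/

/-- Continuous complex-valued functions on the circle `ℝ / 2πℤ`. -/
abbrev CircleFun : Type := C(AddCircle (2 * π), ℂ)

lemma integrable_circleFun (f : CircleFun) : Integrable f AddCircle.haarAddCircle :=
  f.continuous.integrable_of_hasCompactSupport (HasCompactSupport.of_compactSpace _)

/-- The `n`-th Fourier coefficient as a continuous linear functional. -/
noncomputable def coeff (n : ℤ) : CircleFun →L[ℂ] ℂ :=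
  LinearMap.mkContinuous
    { toFun := fun f => fourierCoeff f n
      map_add' := fun f g => by
        rw [ContinuousMap.coe_add, fourierCoeff.add (integrable_circleFun f)
          (integrable_circleFun g), Pi.add_apply]
      map_smul' := fun c f => by
        rw [ContinuousMap.coe_smul, fourierCoeff.const_smul, RingHom.id_apply] } 1
    (fun f => by
      simp only [LinearMap.coe_mk, AddHom.coe_mk, fourierCoeff, one_mul]
      refine (norm_integral_le_of_norm_le_const (C := ‖f‖) (.of_forall fun t => ?_)).trans ?_
      · rw [norm_smul]
        calc _ ≤ 1 * ‖f‖ := by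
              gcongr
              · exact ((fourier (-n)).norm_coe_le_norm t).trans (fourier_norm _).le
              · exact f.norm_coe_le_norm t
          _ = ‖f‖ := one_mul _
      · simp)

lemma coeff_apply (n : ℤ) (f : CircleFun) : coeff n f = fourierCoeff f n := rfl

lemma norm_coeff_le (n : ℤ) (f : CircleFun) : ‖coeff n f‖ ≤ ‖f‖ := by
  simpa using (coeff n).le_of_opNorm_le (LinearMap.mkContinuous_norm_le _ zero_le_one _) f

lemma coeff_fourier_mul (n m : ℤ) (f : CircleFun) :
    coeff n (fourier m * f) = coeff (n - m) f := by
  simp only [coeff_apply, fourierCoeff]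
  congr 1; ext t
  rw [ContinuousMap.mul_apply, smul_eq_mul, smul_eq_mul, ← mul_assoc, ← fourier_add]
  congr 3; ring

lemma coeff_one (n : ℤ) : coeff n (1 : CircleFun) = if n = 0 then 1 else 0 := by
  have h := orthonormal_iff_ite.mp (orthonormal_fourier (T := 2 * π)) n 0
  rw [ContinuousMap.inner_toLp] at h
  rw [← h, coeff_apply, fourierCoeff]
  congr 1; ext t
  rw [fourier_neg, fourier_zero, ContinuousMap.one_apply, smul_eq_mul, one_mul, mul_one]

lemma coeff_fourier (n m : ℤ) : coeff n (fourier m) = if n = m then 1 else 0 := by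
  have h := coeff_fourier_mul n m 1
  rw [mul_one, coeff_one] at h
  simpa [sub_eq_zero] using h

lemma coeff_star (n : ℤ) (f : CircleFun) : coeff n (star f) = conj (coeff (-n) f) := by
  simp only [coeff_apply, fourierCoeff, ← integral_conj]
  congr 1; ext t
  rw [neg_neg, smul_eq_mul, smul_eq_mul, map_mul, fourier_neg]; rfl

lemma summable_coeff_hasSum {f : CircleFun} (h : Summable fun n => coeff n f) :
    HasSum (fun n => coeff n f • fourier n) f :=
  hasSum_fourier_series_of_summable h

/-- If all coefficients of `f - g` vanish, its Fourier series is trivially summable, hence converges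
to `f - g`, and also to zero. -/
lemma circleFun_ext {f g : CircleFun} (h : ∀ n, coeff n f = coeff n g) : f = g := by
  have h0 : ∀ n, coeff n (f - g) = 0 := fun n => by rw [map_sub, h, sub_self]
  have h1 := summable_coeff_hasSum (f := f - g) (by simp only [h0]; exact summable_zero)
  simp only [h0, zero_smul] at h1
  exact sub_eq_zero.mp (h1.unique hasSum_zero)

/-- The Fourier multiplier with an absolutely summable symbol. -/
noncomputable def multiplier (m : ℤ → ℂ) : CircleFun →L[ℂ] CircleFun :=
  ∑' n, m n • (coeff n).smulRight (fourier n)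

lemma norm_multiplier_term_le (m : ℤ → ℂ) (n : ℤ) :
    ‖m n • (coeff n).smulRight (fourier n : CircleFun)‖ ≤ ‖m n‖ := by
  rw [norm_smul]
  refine mul_le_of_le_one_right (norm_nonneg _) ?_
  refine ContinuousLinearMap.opNorm_le_bound _ zero_le_one fun f => ?_
  rw [ContinuousLinearMap.smulRight_apply, norm_smul, fourier_norm, mul_one, one_mul]
  exact norm_coeff_le n f

lemma summable_multiplier {m : ℤ → ℂ} (hm : Summable fun n => ‖m n‖) :
    Summable fun n => m n • (coeff n).smulRight (fourier n : CircleFun) :=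
  .of_norm_bounded hm (norm_multiplier_term_le m)

lemma norm_multiplier_le {m : ℤ → ℂ} (hm : Summable fun n => ‖m n‖) :
    ‖multiplier m‖ ≤ ∑' n, ‖m n‖ :=
  tsum_of_norm_bounded hm.hasSum (norm_multiplier_term_le m)

lemma coeff_multiplier {m : ℤ → ℂ} (hm : Summable fun n => ‖m n‖) (n : ℤ) (f : CircleFun) :
    coeff n (multiplier m f) = m n * coeff n f := by
  have h := (((summable_multiplier hm).hasSum.mapL
    (ContinuousLinearMap.apply ℂ CircleFun f)).mapL (coeff n))
  refine h.unique ?_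
  convert! hasSum_ite_eq n (m n * coeff n f) using 2 with j
  simp only [ContinuousLinearMap.apply_apply,
    ContinuousLinearMap.smulRight_apply, map_smul, coeff_fourier, smul_eq_mul]
  by_cases hj : j = n
  · subst hj; simp
  · simp [hj, Ne.symm hj]

lemma hasSum_sq_coeff (f : CircleFun) :
    HasSum (fun n => ‖coeff n f‖ ^ 2) (∫ t, ‖f t‖ ^ 2 ∂AddCircle.haarAddCircle) := by
  have h := hasSum_sq_fourierCoeff (ContinuousMap.toLp (E := ℂ) 2 AddCircle.haarAddCircle ℂ f)
  simp only [fourierCoeff_toLp] at h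
  convert! h using 1
  refine integral_congr_ae ?_
  filter_upwards [ContinuousMap.coeFn_toLp (p := 2) (𝕜 := ℂ) AddCircle.haarAddCircle f] with t ht
  rw [ht]

/-! ### Differentiation in terms of Fourier coefficients. -/

/-- `G` is the derivative of `F` when both are read as `2π`-periodic functions on the line. -/
def IsDeriv (F G : CircleFun) : Prop :=
  ∀ y : ℝ, HasDerivAt (fun s : ℝ => F s) (G y) y

lemma hasDerivAt_fourier_coe (n : ℤ) (y : ℝ) :
    HasDerivAt (fun s : ℝ => (fourier n : CircleFun) s) (I * n * (fourier n : CircleFun) y) y := by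
  have h := hasDerivAt_fourier (2 * π) n y
  convert! h using 2
  have : (π : ℂ) ≠ 0 := by exact_mod_cast Real.pi_ne_zero
  push_cast; field_simp

lemma IsDeriv.fourier (n : ℤ) : IsDeriv (fourier n) ((I * n) • fourier n) :=
  fun y => by simpa using hasDerivAt_fourier_coe n y

lemma IsDeriv.add {F G F' G' : CircleFun} (h : IsDeriv F G) (h' : IsDeriv F' G') :
    IsDeriv (F + F') (G + G') := fun y => (h y).add (h' y)

lemma IsDeriv.mul {F G F' G' : CircleFun} (h : IsDeriv F G) (h' : IsDeriv F' G') :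
    IsDeriv (F * F') (G * F' + F * G') := fun y => (h y).mul (h' y)

lemma coeff_zero_of_isDeriv {F G : CircleFun} (h : IsDeriv F G) : coeff 0 G = 0 := by
  rw [coeff_apply, fourierCoeff_eq_intervalIntegral _ _ 0]
  simp only [neg_zero, fourier_zero, one_smul]
  rw [intervalIntegral.integral_eq_sub_of_hasDerivAt (fun y _ => h y)
    ((G.continuous.comp (AddCircle.continuous_mk' _)).intervalIntegrable _ _)]
  have : (((0 : ℝ) + 2 * π : ℝ) : AddCircle (2 * π)) = ((0 : ℝ) : AddCircle (2 * π)) := by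
    simp
  rw [this, sub_self, smul_zero]

/-- Integration by parts: the derivative of `fourier (-n) * F` has mean zero. -/
lemma coeff_of_isDeriv {F G : CircleFun} (h : IsDeriv F G) (n : ℤ) :
    coeff n G = I * n * coeff n F := by
  have h1 := coeff_zero_of_isDeriv ((IsDeriv.fourier (-n)).mul h)
  rw [map_add, smul_mul_assoc, map_smul, coeff_fourier_mul, coeff_fourier_mul] at h1
  simp only [zero_sub, neg_neg, smul_eq_mul] at h1
  push_cast at h1
  linear_combination h1

lemma exists_isDeriv {F : CircleFun} (h : Summable fun n : ℤ => ‖I * n * coeff n F‖)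
    (h0 : Summable fun n => coeff n F) : ∃ G, IsDeriv F G := by
  have hb : ∀ n : ℤ, ∀ y : AddCircle (2 * π), ‖(fourier n : CircleFun) y‖ ≤ 1 := fun n y =>
    ((fourier n).norm_coe_le_norm y).trans (fourier_norm _).le
  have hG : Summable fun n : ℤ => (I * n * coeff n F) • (fourier n : CircleFun) :=
    .of_norm_bounded h fun n => by rw [norm_smul, fourier_norm, mul_one]
  refine ⟨∑' n : ℤ, (I * n * coeff n F) • (fourier n : CircleFun), fun y => ?_⟩
  have hF : ∀ y, F y = ∑' n, coeff n F * (fourier n : CircleFun) y := fun y =>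
    (((summable_coeff_hasSum h0).mapL (ContinuousMap.evalCLM ℂ y)).tsum_eq).symm
  have hGy : (∑' n : ℤ, (I * n * coeff n F) • (fourier n : CircleFun)) (y : AddCircle (2 * π))
      = ∑' n : ℤ, coeff n F * (I * n * (fourier n : CircleFun) y) := by
    refine ((hG.hasSum.mapL (ContinuousMap.evalCLM ℂ (y : AddCircle (2 * π)))).tsum_eq).symm.trans
      (tsum_congr fun n => ?_)
    simp only [ContinuousMap.evalCLM_apply, ContinuousMap.smul_apply, smul_eq_mul]; ring
  rw [hGy]
  simp only [hF]
  refine hasDerivAt_tsum (y₀ := 0) h (fun n s => (hasDerivAt_fourier_coe n s).const_mul _)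
    (fun n s => ?_) ?_ y
  · rw [show coeff n F * (I * n * (fourier n : CircleFun) s)
      = (I * n * coeff n F) * (fourier n : CircleFun) s by ring, norm_mul]
    exact mul_le_of_le_one_right (norm_nonneg _) (hb _ _)
  · refine .of_norm_bounded h0.norm fun n => ?_
    rw [norm_mul]
    exact mul_le_of_le_one_right (norm_nonneg _) (hb _ _)

/-! ### From classical waves to Fourier modes, with the energy balance. -/

/-- The symbol of the linear part of the profile equation divided by `k`, with `a = 6 M - c`. -/
noncomputable def symbol (δ k a : ℝ) (n : ℤ) : ℂ :=
  ((a - k ^ 2 * n ^ 2 : ℝ) : ℂ) + I * ((δ * k * n * (1 - k ^ 2 * n ^ 2) : ℝ) : ℂ)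

/-- The Fourier form of the profile equation for a real function with mean zero. -/
structure SolvesModes (δ k a : ℝ) (x : CircleFun) : Prop where
  star_eq : star x = x
  coeff_zero : coeff 0 x = 0
  mode_eq : ∀ n : ℤ, n ≠ 0 → symbol δ k a n * coeff n x + 3 * coeff n (x * x) = 0

lemma circleFun_ext_real {F G : CircleFun} (h : ∀ y : ℝ, F y = G y) : F = G := by
  ext t
  induction t using QuotientAddGroup.induction_on with
  | H y => exact h y

lemma exists_lift {f : ℝ → ℝ} (hc : Continuous f) (hp : Function.Periodic f (2 * π)) :
    ∃ F : CircleFun, (∀ y : ℝ, F y = f y) ∧ star F = F := by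
  refine ⟨⟨fun t => (hp.lift t : ℂ), Complex.continuous_ofReal.comp ?_⟩, fun y => rfl, ?_⟩
  · exact continuous_coinduced_dom.mpr hc
  · exact circleFun_ext_real fun y => Complex.conj_ofReal _

lemma periodic_deriv {f : ℝ → ℝ} {c : ℝ} (h : Function.Periodic f c) :
    Function.Periodic (deriv f) c := fun y => by
  rw [← deriv_comp_add_const, show (fun x => f (x + c)) = f from funext h]

lemma periodic_iteratedDeriv {f : ℝ → ℝ} {c : ℝ} (h : Function.Periodic f c) (n : ℕ) :
    Function.Periodic (iteratedDeriv n f) c := by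
  induction n with
  | zero => simpa using h
  | succ n ih => rw [iteratedDeriv_succ]; exact periodic_deriv ih

lemma coeff_zero_eq_integral (F : CircleFun) :
    coeff 0 F = (2 * π)⁻¹ • ∫ y in (0 : ℝ)..(2 * π), F y := by
  rw [coeff_apply, fourierCoeff_eq_intervalIntegral _ _ 0]
  simp only [neg_zero, fourier_zero, one_smul, zero_add, one_div]

/-- Parseval; for a real function `F * F` equals `|F|²`. -/
lemma coeff_zero_mul_self {F : CircleFun} (h : star F = F) :
    HasSum (fun n => ((‖coeff n F‖ ^ 2 : ℝ) : ℂ)) (coeff 0 (F * F)) := by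
  have h1 := hasSum_sq_coeff F
  rw [← Complex.hasSum_ofReal] at h1
  convert! h1 using 1
  rw [coeff_apply, fourierCoeff]
  refine Eq.trans ?_ integral_ofReal
  congr 1; ext t
  rw [neg_zero, fourier_zero, one_smul, ContinuousMap.mul_apply]
  nth_rewrite 1 [← h]
  rw [ContinuousMap.star_apply, RCLike.star_def, mul_comm, Complex.mul_conj, Complex.normSq_eq_norm_sq]
  rfl

theorem _root_.IsWaveTrain.exists_solvesModes {δ k M c q : ℝ} {V : ℝ → ℝ} (hδ : 0 < δ) (hk : 0 < k)
    (h : IsWaveTrain δ k M c q V) :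
    ∃ x : CircleFun, (∀ y : ℝ, x y = ((V y - M : ℝ) : ℂ)) ∧ SolvesModes δ k (6 * M - c) x ∧
      HasSum (fun n : ℤ => (n : ℝ) ^ 2 * (k ^ 2 * n ^ 2 - 1) * ‖coeff n x‖ ^ 2) 0 := by
  have hV := contDiff_nat_iff_iteratedDeriv (n := 3).mp h.contDiff
  have hcont : ∀ m ≤ 3, Continuous (iteratedDeriv m V) := hV.1
  have hder : ∀ m < 3, ∀ y, HasDerivAt (iteratedDeriv m V) (iteratedDeriv (m + 1) V y) y :=
    fun m hm y => by
      rw [iteratedDeriv_succ]; exact (hV.2 m hm).differentiableAt.hasDerivAt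
  have hper := periodic_iteratedDeriv h.periodic
  have hV0 : iteratedDeriv 0 V = V := iteratedDeriv_zero
  have hV1 : iteratedDeriv 1 V = deriv V := iteratedDeriv_one
  obtain ⟨F0, hF0, hs0⟩ := exists_lift (f := fun y => V y - M)
    (h.contDiff.continuous.sub continuous_const) (fun y => by simp only [h.periodic y])
  obtain ⟨F1, hF1, hs1⟩ := exists_lift (hcont 1 (by norm_num)) (hper 1)
  obtain ⟨F2, hF2, hs2⟩ := exists_lift (hcont 2 (by norm_num)) (hper 2)
  obtain ⟨F3, hF3, hs3⟩ := exists_lift (hcont 3 (by norm_num)) (hper 3)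
  have d0 : IsDeriv F0 F1 := fun y => by
    simp only [hF0, hF1]
    have := hder 0 (by norm_num) y
    rw [hV0] at this
    exact (this.sub_const M).ofReal_comp
  have d1 : IsDeriv F1 F2 := fun y => by
    simp only [hF1, hF2]; exact (hder 1 (by norm_num) y).ofReal_comp
  have d2 : IsDeriv F2 F3 := fun y => by
    simp only [hF2, hF3]; exact (hder 2 (by norm_num) y).ofReal_comp
  have c1 := coeff_of_isDeriv d0
  have c2 := coeff_of_isDeriv d1
  have c3 := coeff_of_isDeriv d2
  set a := 6 * M - c with ha
  have heq : (a : ℂ) • F0 + (3 : ℂ) • (F0 * F0) + ((k ^ 2 : ℝ) : ℂ) • F2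
      + (δ : ℂ) • ((k : ℂ) • F1 + ((k ^ 3 : ℝ) : ℂ) • F3)
      = ((q / k - (3 * M ^ 2 - c * M) : ℝ) : ℂ) • (1 : CircleFun) := by
    refine circleFun_ext_real fun y => ?_
    simp only [ContinuousMap.add_apply, ContinuousMap.smul_apply, ContinuousMap.mul_apply,
      ContinuousMap.one_apply, smul_eq_mul, hF0, hF1, hF2, hF3]
    norm_cast
    rw [hV1]
    have := h.profile_eq y
    field_simp
    rw [ha]
    linear_combination this
  refine ⟨F0, hF0, ⟨hs0, ?_, fun n hn => ?_⟩, ?_⟩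
  · rw [coeff_zero_eq_integral]
    simp only [hF0]
    rw [intervalIntegral.integral_ofReal, intervalIntegral.integral_sub
      (h.contDiff.continuous.intervalIntegrable _ _) intervalIntegrable_const]
    have hm := h.mean_eq
    rw [periodMean] at hm
    have hpi := Real.pi_pos
    rw [intervalIntegral.integral_const, Complex.real_smul, ← Complex.ofReal_mul, mul_sub, hm,
      smul_eq_mul]
    norm_cast
    field_simp
    ring
  · have := congrArg (coeff n) heq
    simp only [map_add, map_smul, smul_eq_mul, coeff_one, if_neg hn, c3, c2, c1] at this
    rw [← this.trans (mul_zero _), symbol]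
    push_cast
    have hI : I ^ 3 = -I := by rw [pow_succ, Complex.I_sq]; ring
    linear_combination (-(k : ℂ) ^ 2 * n ^ 2 * coeff n F0) * Complex.I_sq
      - (δ * (k : ℂ) ^ 3 * n ^ 3 * coeff n F0) * hI
  -- Energy balance: in the pairing with `x'`, the terms `x x'`, `x² x'`, `x'' x'` and the constant
  -- times `x'` are exact derivatives, and `⟨x''' x'⟩ = -⟨x''²⟩`. What remains is `δk (⟨x'²⟩ - k²
  -- ⟨x''²⟩) = 0`, so dispersion and nonlinearity drop out.
  · have e := congrArg (fun G => coeff 0 (G * F1)) heq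
    simp only [add_mul, smul_mul_assoc, map_add, map_smul, smul_eq_mul, one_mul, smul_add] at e
    have z1 := coeff_zero_of_isDeriv (d0.mul d0)
    have z2 := coeff_zero_of_isDeriv ((d0.mul d0).mul d0)
    have z3 := coeff_zero_of_isDeriv (d1.mul d1)
    have z4 := coeff_zero_of_isDeriv (d2.mul d1)
    have z5 := coeff_zero_of_isDeriv d0
    rw [show F1 * F0 + F0 * F1 = (2 : ℂ) • (F0 * F1) by rw [two_smul, mul_comm F1], map_smul,
      smul_eq_mul] at z1
    rw [show (F1 * F0 + F0 * F1) * F0 + F0 * F0 * F1 = (3 : ℂ) • (F0 * F0 * F1) by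
      ext t; simp; ring, map_smul, smul_eq_mul] at z2
    rw [show F2 * F1 + F1 * F2 = (2 : ℂ) • (F2 * F1) by rw [two_smul, mul_comm F1], map_smul,
      smul_eq_mul] at z3
    rw [map_add] at z4
    have hδ' : (δ : ℂ) * k ≠ 0 := by
      simp [hδ.ne', hk.ne']
    have key : (k : ℂ) ^ 2 * coeff 0 (F2 * F2) - coeff 0 (F1 * F1) = 0 := by
      refine (mul_eq_zero.mp ?_).resolve_left hδ'
      push_cast at e
      linear_combination -e + (a / 2 : ℂ) * z1 + z2 + (k ^ 2 / 2 : ℂ) * z3 + δ * k ^ 3 * z4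
        - (q / k - (3 * M ^ 2 - c * M) : ℂ) * z5
    have hs := ((coeff_zero_mul_self hs2).mul_left ((k : ℂ) ^ 2)).sub (coeff_zero_mul_self hs1)
    rw [key] at hs
    rw [← Complex.hasSum_ofReal]
    convert! hs using 1
    ext n
    rw [c2, c1]
    simp only [norm_mul, Complex.norm_I, one_mul, Complex.norm_intCast, mul_pow, sq_abs]
    push_cast; ring

/-! ### Regularity: from Fourier modes back to classical waves. -/

lemma exists_isDeriv_of_cube_bound {F : CircleFun} {B : ℝ}
    (h : ∀ n : ℤ, |(n : ℝ)| ^ 3 * ‖coeff n F‖ ≤ B) : ∃ G, IsDeriv F G := by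
  have hs : Summable fun n : ℤ => B * (1 / (n : ℝ) ^ 2) :=
    (Real.summable_one_div_int_pow.mpr one_lt_two).mul_left B
  have hb : ∀ n : ℤ, ‖I * n * coeff n F‖ ≤ B * (1 / (n : ℝ) ^ 2) := fun n => by
    rcases eq_or_ne n 0 with rfl | hn
    · simp
    have hn' : 0 < |(n : ℝ)| := by positivity
    rw [norm_mul, norm_mul, Complex.norm_I, one_mul, Complex.norm_intCast, mul_one_div,
      le_div_iff₀ (by positivity), ← sq_abs]
    linarith [h n]
  have h1 := Summable.of_nonneg_of_le (fun n => norm_nonneg _) hb hs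
  refine exists_isDeriv h1 ?_
  refine .of_norm_bounded (h1.add (hasSum_ite_eq (0 : ℤ) ‖coeff 0 F‖).summable) fun n => ?_
  rcases eq_or_ne n 0 with rfl | hn
  · simp
  have hn' : 1 ≤ |(n : ℝ)| := by exact_mod_cast Int.one_le_abs hn
  rw [if_neg hn, add_zero, norm_mul, norm_mul, Complex.norm_I, one_mul, Complex.norm_intCast]
  exact le_mul_of_one_le_left (norm_nonneg _) hn'

/-- The imaginary part alone grows cubically, so the bound is uniform in `a`. -/
lemma symbol_lower_bound {δ k : ℝ} (hδ : 0 < δ) (hk : 0 < k) (hk2 : 1 / 2 ≤ k ^ 2) (a : ℝ) {n : ℤ}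
    (hn : 2 ≤ |n|) : δ * k / 4 * |(n : ℝ)| ^ 3 ≤ ‖symbol δ k a n‖ := by
  have h2 : (2 : ℝ) ≤ |(n : ℝ)| := by exact_mod_cast hn
  have h4 : (4 : ℝ) ≤ (n : ℝ) ^ 2 := by rw [← sq_abs]; nlinarith
  have : (n : ℝ) ^ 2 / 4 ≤ k ^ 2 * n ^ 2 - 1 := by nlinarith
  have hi : (symbol δ k a n).im = δ * k * n * (1 - k ^ 2 * n ^ 2) := by
    rw [symbol, Complex.add_im, Complex.ofReal_im, Complex.I_mul_im, Complex.ofReal_re, zero_add]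
  refine le_trans ?_ (Complex.abs_im_le_norm _)
  rw [hi, abs_mul, abs_mul, abs_of_pos (mul_pos hδ hk), abs_sub_comm,
    abs_of_nonneg (show 0 ≤ k ^ 2 * (n : ℝ) ^ 2 - 1 by linarith), pow_succ', sq_abs]
  calc _ = δ * k * |(n : ℝ)| * ((n : ℝ) ^ 2 / 4) := by ring
    _ ≤ _ := by gcongr

/-- Each application of the mode equation gains three powers of `n`, because the symbol is cubic.
The modes `|n| ≤ 1`, where it may vanish, are bounded by `‖x‖`. -/
lemma SolvesModes.decay {δ k a : ℝ} (hδ : 0 < δ) (hk : 0 < k) (hk2 : 1 / 2 ≤ k ^ 2)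
    {x : CircleFun} (h : SolvesModes δ k a x) {j : ℕ} {B : ℝ}
    (hB : ∀ n : ℤ, |(n : ℝ)| ^ j * ‖coeff n (x * x)‖ ≤ B) :
    ∃ B', ∀ n : ℤ, |(n : ℝ)| ^ (j + 3) * ‖coeff n x‖ ≤ B' := by
  refine ⟨max ‖x‖ (12 * B / (δ * k)), fun n => ?_⟩
  by_cases hn : 2 ≤ |n|
  · refine le_max_of_le_right ?_
    have hn0 : n ≠ 0 := by rintro rfl; simp at hn
    have e := h.mode_eq n hn0
    have e' : ‖symbol δ k a n‖ * ‖coeff n x‖ = 3 * ‖coeff n (x * x)‖ := by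
      rw [← norm_mul, eq_neg_of_add_eq_zero_left e, norm_neg, norm_mul]; norm_num
    rw [le_div_iff₀ (by positivity)]
    calc _ = 4 * |(n : ℝ)| ^ j * ((δ * k / 4 * |(n : ℝ)| ^ 3) * ‖coeff n x‖) := by ring
      _ ≤ 4 * |(n : ℝ)| ^ j * (‖symbol δ k a n‖ * ‖coeff n x‖) := by
        gcongr; exact symbol_lower_bound hδ hk hk2 a hn
      _ = 12 * (|(n : ℝ)| ^ j * ‖coeff n (x * x)‖) := by rw [e']; ring
      _ ≤ _ := by gcongr; exact hB n
  · refine le_max_of_le_left ?_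
    have : |(n : ℝ)| ≤ 1 := by
      have : |n| ≤ 1 := by omega
      exact_mod_cast this
    calc _ ≤ 1 * ‖x‖ := by
          gcongr
          · exact pow_le_one₀ (abs_nonneg _) this
          · exact norm_coeff_le n x
      _ = _ := one_mul _

lemma pow_mul_norm_coeff_of_isDeriv {F G : CircleFun} (h : IsDeriv F G) (j : ℕ) (n : ℤ) :
    |(n : ℝ)| ^ j * ‖coeff n G‖ = |(n : ℝ)| ^ (j + 1) * ‖coeff n F‖ := by
  rw [coeff_of_isDeriv h, norm_mul, norm_mul, Complex.norm_I, Complex.norm_intCast]; ring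

/-- Bootstrap: `x²` is differentiable as often as `x` is, which gives its coefficients decay of
order 0, 1, 2 in turn. Those of `x` then decay to order 3, 4, 5, and each round yields one more
derivative. -/
theorem SolvesModes.exists_isDeriv {δ k a : ℝ} (hδ : 0 < δ) (hk : 0 < k) (hk2 : 1 / 2 ≤ k ^ 2)
    {x : CircleFun} (h : SolvesModes δ k a x) :
    ∃ F1 F2 F3, IsDeriv x F1 ∧ IsDeriv F1 F2 ∧ IsDeriv F2 F3 := by
  obtain ⟨B0, hB0⟩ := h.decay hδ hk hk2 (j := 0) (B := ‖x * x‖)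
    fun n => by simpa using norm_coeff_le n (x * x)
  obtain ⟨F1, d0⟩ := exists_isDeriv_of_cube_bound hB0
  have e1 := d0.mul d0
  obtain ⟨B1, hB1⟩ := h.decay hδ hk hk2 (j := 1) fun n => by
    rw [← pow_mul_norm_coeff_of_isDeriv e1 0, pow_zero, one_mul]
    exact norm_coeff_le n _
  obtain ⟨F2, d1⟩ := exists_isDeriv_of_cube_bound (F := F1) (B := B1) fun n => by
    rw [pow_mul_norm_coeff_of_isDeriv d0]; exact hB1 n
  have e2 := (d1.mul d0).add (d0.mul d1)
  obtain ⟨B2, hB2⟩ := h.decay hδ hk hk2 (j := 2) fun n => by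
    rw [← pow_mul_norm_coeff_of_isDeriv e1 1, ← pow_mul_norm_coeff_of_isDeriv e2 0, pow_zero,
      one_mul]
    exact norm_coeff_le n _
  obtain ⟨F3, d2⟩ := exists_isDeriv_of_cube_bound (F := F2) (B := B2) fun n => by
    rw [pow_mul_norm_coeff_of_isDeriv d1, pow_mul_norm_coeff_of_isDeriv d0]; exact hB2 n
  exact ⟨F1, F2, F3, d0, d1, d2⟩

/-- The zero mode imposes no condition: it defines the integration constant. A nonzero first mode
excludes constants. -/
theorem SolvesModes.isWaveTrain {δ k a : ℝ} (M : ℝ) (hδ : 0 < δ) (hk : 0 < k)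
    (hk2 : 1 / 2 ≤ k ^ 2) {x : CircleFun} (h : SolvesModes δ k a x) (h1 : coeff 1 x ≠ 0) :
    IsWaveTrain δ k M (6 * M - a)
      (k * (3 * M ^ 2 - (6 * M - a) * M) + 3 * k * (coeff 0 (x * x)).re)
      (fun y => M + (x y).re) := by
  obtain ⟨F1, F2, F3, d0, d1, d2⟩ := h.exists_isDeriv hδ hk hk2
  have c1 := coeff_of_isDeriv d0
  have c2 := coeff_of_isDeriv d1
  have c3 := coeff_of_isDeriv d2
  have hreal : ∀ t, ((x t).re : ℂ) = x t := fun t =>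
    Complex.conj_eq_iff_re.mp (DFunLike.congr_fun h.star_eq t)
  have re_der : ∀ {F G : CircleFun}, IsDeriv F G →
      ∀ y : ℝ, HasDerivAt (fun s : ℝ => (F s).re) (G y).re y := fun hFG y =>
    Complex.reCLM.hasFDerivAt.comp_hasDerivAt y (hFG y)
  have re_cont : ∀ F : CircleFun, Continuous fun y : ℝ => (F y).re := fun F =>
    Complex.continuous_re.comp (F.continuous.comp (AddCircle.continuous_mk' _))
  set U : ℝ → ℝ := fun y => M + (x y).re with hU
  have g0 : ∀ y : ℝ, HasDerivAt U (F1 y).re y := fun y => (re_der d0 y).const_add M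
  have i0 : iteratedDeriv 0 U = U := iteratedDeriv_zero
  have i1 : iteratedDeriv 1 U = fun y : ℝ => (F1 y).re := by
    rw [iteratedDeriv_one]; exact funext fun y => (g0 y).deriv
  have i2 : iteratedDeriv 2 U = fun y : ℝ => (F2 y).re := by
    rw [iteratedDeriv_succ, i1]; exact funext fun y => (re_der d1 y).deriv
  have i3 : iteratedDeriv 3 U = fun y : ℝ => (F3 y).re := by
    rw [iteratedDeriv_succ, i2]; exact funext fun y => (re_der d2 y).deriv
  have heq : (a : ℂ) • x + (3 : ℂ) • (x * x) + ((k ^ 2 : ℝ) : ℂ) • F2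
      + (δ : ℂ) • ((k : ℂ) • F1 + ((k ^ 3 : ℝ) : ℂ) • F3)
      = (3 * coeff 0 (x * x)) • (1 : CircleFun) := by
    refine circleFun_ext fun n => ?_
    simp only [map_add, map_smul, smul_eq_mul, coeff_one, c3, c2, c1]
    split_ifs with hn
    · subst hn
      simp [h.coeff_zero]
    · have := h.mode_eq n hn
      rw [symbol] at this
      push_cast at this ⊢
      have hI : I ^ 3 = -I := by rw [pow_succ, Complex.I_sq]; ring
      linear_combination this + ((k : ℂ) ^ 2 * n ^ 2 * coeff n x) * Complex.I_sq
        + (δ * (k : ℂ) ^ 3 * n ^ 3 * coeff n x) * hI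
  refine ⟨?_, fun y => ?_, ?_, fun y => ?_, ?_⟩
  · refine contDiff_nat_iff_iteratedDeriv (n := 3).mpr ⟨fun m hm => ?_, fun m hm => ?_⟩
    · interval_cases m
      · rw [i0]; exact (re_cont x).const_add M
      · rw [i1]; exact re_cont F1
      · rw [i2]; exact re_cont F2
      · rw [i3]; exact re_cont F3
    · interval_cases m
      · rw [i0]; exact fun y => (g0 y).differentiableAt
      · rw [i1]; exact fun y => (re_der d1 y).differentiableAt
      · rw [i2]; exact fun y => (re_der d2 y).differentiableAt
  · simp [hU]
  · by_contra! hc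
    refine h1 ?_
    have : x = (x 0) • (1 : CircleFun) := circleFun_ext_real fun y => by
      have h' : (x y).re = (x (0 : ℝ)).re := by simpa [hU] using hc y 0
      simp only [ContinuousMap.smul_apply, ContinuousMap.one_apply, smul_eq_mul, mul_one]
      rw [← hreal, h']
      exact hreal _
    rw [this, map_smul, coeff_one]
    simp
  · rw [← iteratedDeriv_one, i1, i2, i3]
    have e := congrArg Complex.re (DFunLike.congr_fun heq (y : AddCircle (2 * π)))
    simp only [ContinuousMap.add_apply, ContinuousMap.smul_apply, ContinuousMap.mul_apply,
      ContinuousMap.one_apply, smul_eq_mul] at e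
    rw [← hreal] at e
    have e2 : (3 * coeff 0 (x * x) * 1).re = 3 * (coeff 0 (x * x)).re := by
      simp
    rw [e2] at e
    simp only [Complex.add_re, Complex.re_ofReal_mul, ← Complex.ofReal_mul, Complex.ofReal_re] at e
    rw [show ((3 : ℂ) * (((x y).re * (x y).re : ℝ) : ℂ)).re = 3 * ((x y).re * (x y).re) from
      Complex.re_ofReal_mul 3 _] at e
    simp only [hU]
    linear_combination k * e
  · have h0 := h.coeff_zero
    rw [coeff_zero_eq_integral] at h0
    have : (∫ y in (0 : ℝ)..(2 * π), (x y).re) = 0 := by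
      have hpi := Real.pi_pos
      have h0' := (smul_eq_zero.mp h0).resolve_left (by positivity)
      rw [← intervalIntegral.integral_congr (fun y _ => hreal (y : AddCircle (2 * π)))] at h0'
      rw [intervalIntegral.integral_ofReal] at h0'
      exact_mod_cast h0'
    rw [periodMean, intervalIntegral.integral_add intervalIntegrable_const
      ((re_cont x).intervalIntegrable _ _), this, intervalIntegral.integral_const, smul_eq_mul]
    have hpi := Real.pi_pos
    field_simp
    ring

/-! ### The admissible wavenumbers and the inverse on the modes `|n| ≥ 2`. -/

/-- The parameter range in which all estimates are uniform. -/
structure Admissible (k : ℝ) : Prop where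
  pos : 0 < k
  half_le_sq : 1 / 2 ≤ k ^ 2
  lt_one : k < 1

lemma Admissible.sq_lt_one {k : ℝ} (hk : Admissible k) : k ^ 2 < 1 := by
  have := hk.pos; have := hk.lt_one; nlinarith

lemma Admissible.half_le {k : ℝ} (hk : Admissible k) : 1 / 2 ≤ k := by
  have := hk.pos; have := hk.lt_one; have := hk.half_le_sq; nlinarith

/-- The small parameter `ε` with `ε ^ 2 = 1 - k ^ 2`. -/
noncomputable def small (k : ℝ) : ℝ := √(1 - k ^ 2)

lemma Admissible.small_pos {k : ℝ} (hk : Admissible k) : 0 < small k :=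
  Real.sqrt_pos.mpr (sub_pos.mpr hk.sq_lt_one)

lemma Admissible.small_sq {k : ℝ} (hk : Admissible k) : small k ^ 2 = 1 - k ^ 2 :=
  Real.sq_sqrt (sub_pos.mpr hk.sq_lt_one).le

lemma Admissible.small_le_one {k : ℝ} (hk : Admissible k) : small k ≤ 1 := by
  have := hk.small_sq; have := hk.small_pos; nlinarith [sq_nonneg k]

/-- The inverse of the symbol at the bifurcation speed, on the modes `|n| ≥ 2`. -/
noncomputable def invSymbol (δ k : ℝ) (n : ℤ) : ℂ :=
  if 2 ≤ |n| then (symbol δ k (k ^ 2) n)⁻¹ else 0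

lemma symbol_re (δ k a : ℝ) (n : ℤ) : (symbol δ k a n).re = a - k ^ 2 * n ^ 2 := by
  rw [symbol, Complex.add_re, Complex.ofReal_re, Complex.I_mul_re, Complex.ofReal_im, neg_zero,
    add_zero]

lemma symbol_im (δ k a : ℝ) (n : ℤ) :
    (symbol δ k a n).im = δ * k * n * (1 - k ^ 2 * n ^ 2) := by
  rw [symbol, Complex.add_im, Complex.ofReal_im, Complex.I_mul_im, Complex.ofReal_re, zero_add]

lemma four_le_sq_of_two_le_abs {n : ℤ} (hn : 2 ≤ |n|) : (4 : ℝ) ≤ (n : ℝ) ^ 2 := by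
  have h2 : (2 : ℝ) ≤ |(n : ℝ)| := by exact_mod_cast hn
  rw [← sq_abs]; nlinarith

/-- Here the real part `k² (1 - n²)` suffices: quadratic growth, independent of `δ`, already makes
the inverse symbol summable. -/
lemma sq_le_norm_symbol {δ k : ℝ} (hk : Admissible k) {n : ℤ} (hn : 2 ≤ |n|) :
    (n : ℝ) ^ 2 / 4 ≤ ‖symbol δ k (k ^ 2) n‖ := by
  have h4 := four_le_sq_of_two_le_abs hn
  refine le_trans ?_ (Complex.abs_re_le_norm _)
  rw [symbol_re, abs_sub_comm]
  refine le_trans ?_ (le_abs_self _)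
  nlinarith [hk.half_le_sq]

lemma symbol_ne_zero {δ k : ℝ} (hk : Admissible k) {n : ℤ} (hn : 2 ≤ |n|) :
    symbol δ k (k ^ 2) n ≠ 0 := by
  have h4 := four_le_sq_of_two_le_abs hn
  have := sq_le_norm_symbol (δ := δ) hk hn
  exact norm_pos_iff.mp (by linarith)

lemma norm_invSymbol_le {δ k : ℝ} (hk : Admissible k) (n : ℤ) :
    ‖invSymbol δ k n‖ ≤ 4 * (1 / (n : ℝ) ^ 2) := by
  rw [invSymbol]
  split_ifs with hn
  · have h4 := four_le_sq_of_two_le_abs hn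
    have := sq_le_norm_symbol (δ := δ) hk hn
    rw [norm_inv, mul_one_div, ← inv_div]
    gcongr
  · rw [norm_zero]; positivity

lemma norm_invSymbol_two_le {δ k : ℝ} (hk : Admissible k) : ‖invSymbol δ k 2‖ ≤ 1 := by
  have := norm_invSymbol_le (δ := δ) hk 2
  norm_num at this ⊢
  exact this

lemma summable_four_div_sq : Summable fun n : ℤ => 4 * (1 / (n : ℝ) ^ 2) :=
  (Real.summable_one_div_int_pow.mpr one_lt_two).mul_left 4

lemma summable_invSymbol {δ k : ℝ} (hk : Admissible k) : Summable fun n => ‖invSymbol δ k n‖ :=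
  .of_nonneg_of_le (fun _ => norm_nonneg _) (norm_invSymbol_le hk) summable_four_div_sq

/-- The solution operator of the linear profile equation on the modes `|n| ≥ 2`. -/
noncomputable def solveLin (δ k : ℝ) : CircleFun →L[ℂ] CircleFun := multiplier (invSymbol δ k)

lemma norm_solveLin_le {δ k : ℝ} (hk : Admissible k) :
    ‖solveLin δ k‖ ≤ ∑' n : ℤ, 4 * (1 / (n : ℝ) ^ 2) :=
  (norm_multiplier_le (summable_invSymbol hk)).trans
    ((summable_invSymbol hk).tsum_le_tsum (norm_invSymbol_le hk) summable_four_div_sq)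

lemma coeff_solveLin {δ k : ℝ} (hk : Admissible k) (n : ℤ) (f : CircleFun) :
    coeff n (solveLin δ k f) = invSymbol δ k n * coeff n f :=
  coeff_multiplier (summable_invSymbol hk) n f

lemma symbol_neg (δ k a : ℝ) (n : ℤ) : symbol δ k a (-n) = conj (symbol δ k a n) := by
  apply Complex.ext
  · rw [Complex.conj_re, symbol_re, symbol_re]; push_cast; ring
  · rw [Complex.conj_im, symbol_im, symbol_im]; push_cast; ring

lemma invSymbol_neg (δ k : ℝ) (n : ℤ) : invSymbol δ k (-n) = conj (invSymbol δ k n) := by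
  rw [invSymbol, invSymbol, abs_neg]
  split_ifs
  · rw [symbol_neg, map_inv₀]
  · rw [map_zero]

lemma star_solveLin {δ k : ℝ} (hk : Admissible k) (f : CircleFun) :
    star (solveLin δ k f) = solveLin δ k (star f) := by
  refine circleFun_ext fun n => ?_
  rw [coeff_star, coeff_solveLin hk, coeff_solveLin hk, coeff_star, invSymbol_neg, map_mul,
    Complex.conj_conj]

lemma symbol_two_im (δ k : ℝ) : (symbol δ k (k ^ 2) 2).im = -(2 * δ * k * (4 * k ^ 2 - 1)) := by
  rw [symbol_im]; push_cast; ring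

/-- This sign decides the direction of the bifurcation: it makes the leading `β` positive for `k <
1`. The denominator bounds `|symbol|² = 9k⁴ + 4δ²k²(4k² - 1)²`. -/
lemma invSymbol_two_im_lower {δ k : ℝ} (hδ : 0 < δ) (hk : Admissible k) :
    δ / (9 + 36 * δ ^ 2) ≤ (invSymbol δ k 2).im := by
  have h1 := hk.half_le
  have h2 := hk.half_le_sq
  have h3 := hk.sq_lt_one
  have h4 := hk.pos
  have hpos := Complex.normSq_pos.mpr (symbol_ne_zero (δ := δ) hk (n := 2) (by norm_num))
  rw [invSymbol, if_pos (by norm_num), Complex.inv_im, symbol_two_im, neg_neg]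
  have hle : Complex.normSq (symbol δ k (k ^ 2) 2) ≤ 9 + 36 * δ ^ 2 := by
    rw [Complex.normSq_apply, symbol_two_im, symbol_re]
    push_cast
    have e1 : k ^ 2 * (k ^ 2) ≤ 1 := by nlinarith
    have e2 : k ^ 2 * (4 * k ^ 2 - 1) ^ 2 ≤ 9 := by
      have : (4 * k ^ 2 - 1) ^ 2 ≤ 9 := by nlinarith
      nlinarith [sq_nonneg (4 * k ^ 2 - 1)]
    nlinarith [mul_le_mul_of_nonneg_left e2 (sq_nonneg δ)]
  have hnum : δ ≤ 2 * δ * k * (4 * k ^ 2 - 1) := by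
    have : 1 ≤ 2 * k * (4 * k ^ 2 - 1) := by nlinarith
    nlinarith
  exact div_le_div₀ (hδ.le.trans hnum) hnum hpos hle

/-! ### Rescaling by the amplitude. -/

/-- `e^{iy} + e^{-iy}`. -/
noncomputable def cosOne : CircleFun := fourier 1 + fourier (-1)

/-- `e^{2iy} + e^{-2iy}`. -/
noncomputable def cosTwo : CircleFun := fourier 2 + fourier (-2)

lemma star_fourier (n : ℤ) : star (fourier n : CircleFun) = fourier (-n) := by
  ext t; rw [ContinuousMap.star_apply, fourier_neg]; rfl

lemma star_cosOne : star cosOne = cosOne := by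
  rw [cosOne, star_add, star_fourier, star_fourier, neg_neg, add_comm]

lemma star_cosTwo : star cosTwo = cosTwo := by
  rw [cosTwo, star_add, star_fourier, star_fourier, neg_neg, add_comm]

lemma norm_cosOne_le : ‖cosOne‖ ≤ 2 :=
  (norm_add_le _ _).trans (by rw [fourier_norm, fourier_norm]; norm_num)

lemma norm_cosTwo_le : ‖cosTwo‖ ≤ 2 :=
  (norm_add_le _ _).trans (by rw [fourier_norm, fourier_norm]; norm_num)

lemma coeff_cosOne (n : ℤ) :
    coeff n cosOne = (if n = 1 then 1 else 0) + if n = -1 then 1 else 0 := by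
  rw [cosOne, map_add, coeff_fourier, coeff_fourier]

lemma coeff_cosTwo (n : ℤ) :
    coeff n cosTwo = (if n = 2 then 1 else 0) + if n = -2 then 1 else 0 := by
  rw [cosTwo, map_add, coeff_fourier, coeff_fourier]

lemma coeff_cosOne_mul (n : ℤ) (f : CircleFun) :
    coeff n (cosOne * f) = coeff (n - 1) f + coeff (n + 1) f := by
  rw [cosOne, add_mul, map_add, coeff_fourier_mul, coeff_fourier_mul, sub_neg_eq_add]

lemma cosOne_mul_cosOne : cosOne * cosOne = cosTwo + (2 : ℂ) • (1 : CircleFun) := by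
  refine circleFun_ext fun n => ?_
  rw [coeff_cosOne_mul, coeff_cosOne, coeff_cosOne, map_add, coeff_cosTwo, map_smul, coeff_one]
  rcases eq_or_ne n 0 with rfl | h0
  · norm_num
  · simp only [h0, if_false, smul_zero, add_zero]
    rw [if_neg (show ¬ n - 1 = -1 by omega), if_neg (show ¬ n + 1 = 1 by omega), add_zero, zero_add]
    congr 2 <;> · apply propext; omega

/-- The nonlinear remainder of the rescaled equation, with speed correction `b`. -/
noncomputable def remainder (ε b β : ℝ) (z : CircleFun) : CircleFun :=
  ((ε * b : ℝ) : ℂ) • z + (3 : ℂ) • (((2 * √β : ℝ) : ℂ) • (cosOne * z)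
    + ((ε * β : ℝ) : ℂ) • (z * z))

/-- The left-hand side, apart from `b + i δ k`, of the rescaled equation of the mode `n = 1`. -/
noncomputable def firstMode (ε β : ℝ) (z : CircleFun) : ℂ :=
  ((6 * β : ℝ) : ℂ) * coeff 2 z + ((3 * ε * (√β * β) : ℝ) : ℂ) * coeff 1 (z * z)

/-- The wave profile of amplitude `A` with higher modes `A ^ 2 * z`. -/
noncomputable def profile (A : ℝ) (z : CircleFun) : CircleFun :=
  (A : ℂ) • cosOne + ((A ^ 2 : ℝ) : ℂ) • z

lemma star_real_smul (r : ℝ) (f : CircleFun) : star ((r : ℂ) • f) = (r : ℂ) • star f := by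
  rw [star_smul]; congr 1; exact Complex.conj_ofReal r

lemma profile_sq (A : ℝ) (z : CircleFun) : profile A z * profile A z =
    ((A ^ 2 : ℝ) : ℂ) • cosTwo + ((2 * A ^ 2 : ℝ) : ℂ) • (1 : CircleFun)
      + ((2 * A ^ 3 : ℝ) : ℂ) • (cosOne * z) + ((A ^ 4 : ℝ) : ℂ) • (z * z) := by
  have h : profile A z * profile A z = ((A ^ 2 : ℝ) : ℂ) • (cosOne * cosOne)
      + ((2 * A ^ 3 : ℝ) : ℂ) • (cosOne * z) + ((A ^ 4 : ℝ) : ℂ) • (z * z) := by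
    ext t
    simp only [profile, ContinuousMap.add_apply, ContinuousMap.smul_apply,
      ContinuousMap.mul_apply, smul_eq_mul]
    push_cast; ring
  rw [h, cosOne_mul_cosOne, smul_add, smul_smul]
  push_cast
  congr 4
  ring

lemma coeff_neg_of_star_eq {f : CircleFun} (h : star f = f) (n : ℤ) :
    coeff (-n) f = conj (coeff n f) := by
  have := coeff_star (-n) f
  rwa [h, neg_neg] at this

lemma mode_eq_neg {δ k a : ℝ} {x : CircleFun} (h : star x = x) {n : ℤ}
    (hn : symbol δ k a n * coeff n x + 3 * coeff n (x * x) = 0) :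
    symbol δ k a (-n) * coeff (-n) x + 3 * coeff (-n) (x * x) = 0 := by
  have hxx : star (x * x) = x * x := by rw [star_mul, h]
  rw [coeff_neg_of_star_eq h, coeff_neg_of_star_eq hxx, symbol_neg]
  have := congrArg conj hn
  rwa [map_add, map_mul, map_mul, map_zero, map_ofNat] at this

/-- The rescaled form of the profile equation. -/
structure ScaledModes (δ k b β : ℝ) (z : CircleFun) : Prop where
  star_eq : star z = z
  low : ∀ n : ℤ, |n| ≤ 1 → coeff n z = 0
  first : (b : ℂ) + I * (δ * k : ℝ) + firstMode (small k) β z = 0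
  high : ∀ n : ℤ, 2 ≤ |n| → symbol δ k (k ^ 2) n * coeff n z + 3 * coeff n cosTwo
    + small k * coeff n (remainder (small k) b β z) = 0

/-- Mode 1 carries the common factor `ε² A`, since its symbol is `ε² (b + iδk)` and `(e^{iy} +
e^{-iy})²` has no first harmonic. The modes `|n| ≥ 2` carry the factor `A²`. Mode `-1` follows from
mode 1 by conjugation. -/
theorem solvesModes_profile_iff {δ k b β : ℝ} (hk : Admissible k) (hβ : 0 < β) {z : CircleFun}
    (hs : star z = z) (hlow : ∀ n : ℤ, |n| ≤ 1 → coeff n z = 0) :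
    SolvesModes δ k (k ^ 2 + small k ^ 2 * b) (profile (small k * √β) z) ↔
      ScaledModes δ k b β z := by
  have hε := hk.small_pos
  have hε2 := hk.small_sq
  have hA : 0 < small k * √β := mul_pos hε (Real.sqrt_pos.mpr hβ)
  set ε := small k with hεdef
  set A := ε * √β with hAdef
  have hα2 : (√β : ℂ) ^ 2 = β := by
    rw [← Complex.ofReal_pow, Real.sq_sqrt hβ.le]
  have hAc : (A : ℂ) = ε * √β := by rw [hAdef]; push_cast; ring
  have hA0 : (A : ℂ) ≠ 0 := by exact_mod_cast hA.ne'
  have hxs : star (profile A z) = profile A z := by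
    rw [profile, star_add, star_real_smul, star_real_smul, star_cosOne, hs]
  have h1 : symbol δ k (k ^ 2 + ε ^ 2 * b) 1 * coeff 1 (profile A z)
      + 3 * coeff 1 (profile A z * profile A z)
      = ε ^ 2 * A * ((b : ℂ) + I * (δ * k : ℝ) + firstMode ε β z) := by
    have hsym : symbol δ k (k ^ 2 + ε ^ 2 * b) 1 = ε ^ 2 * (b + I * (δ * k : ℝ)) := by
      have : (k : ℂ) ^ 2 = 1 - ε ^ 2 := by
        rw [← Complex.ofReal_pow, ← Complex.ofReal_pow, hε2]; push_cast; ring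
      rw [symbol]
      push_cast
      rw [this]
      ring
    rw [hsym, profile_sq, profile, firstMode]
    simp only [map_add, map_smul, smul_eq_mul, coeff_cosOne_mul, coeff_cosOne, coeff_cosTwo,
      coeff_one]
    norm_num
    rw [hlow 0 (by norm_num), hlow 1 (by norm_num), ← hα2, hAc]
    ring
  have hn : ∀ n : ℤ, 2 ≤ |n| → symbol δ k (k ^ 2 + ε ^ 2 * b) n * coeff n (profile A z)
      + 3 * coeff n (profile A z * profile A z)
      = A ^ 2 * (symbol δ k (k ^ 2) n * coeff n z + 3 * coeff n cosTwo
        + ε * coeff n (remainder ε b β z)) := fun n hn => by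
    have e1 : coeff n cosOne = 0 := by
      rw [coeff_cosOne, if_neg (by rintro rfl; norm_num at hn), if_neg (by rintro rfl; norm_num at hn),
        add_zero]
    have e2 : coeff n (1 : CircleFun) = 0 := by
      rw [coeff_one, if_neg (by rintro rfl; norm_num at hn)]
    have hsym : symbol δ k (k ^ 2 + ε ^ 2 * b) n = symbol δ k (k ^ 2) n + ε ^ 2 * b := by
      rw [symbol, symbol]; push_cast; ring
    rw [hsym, profile_sq, profile, remainder]
    simp only [map_add, map_smul, smul_eq_mul, e1, e2]
    push_cast
    rw [← hα2, hAc]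
    ring
  constructor
  · refine fun h => ⟨hs, hlow, ?_, fun n hn2 => ?_⟩
    · have e := h.mode_eq 1 one_ne_zero
      rw [h1] at e
      refine (mul_eq_zero.mp e).resolve_left (mul_ne_zero (pow_ne_zero 2 ?_) hA0)
      exact_mod_cast hε.ne'
    · have e := h.mode_eq n (by rintro rfl; norm_num at hn2)
      rw [hn n hn2] at e
      exact (mul_eq_zero.mp e).resolve_left (pow_ne_zero 2 hA0)
  · refine fun h => ⟨hxs, ?_, fun n hn0 => ?_⟩
    · rw [profile, map_add, map_smul, map_smul, hlow 0 (by norm_num), coeff_cosOne]; simp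
    · by_cases hn2 : 2 ≤ |n|
      · rw [hn n hn2, h.high n hn2, mul_zero]
      · have e1 := h1.trans (by rw [h.first, mul_zero])
        have : n = 1 ∨ n = -1 := by
          rcases abs_cases n with h | h <;> omega
        rcases this with rfl | rfl
        · exact e1
        · exact mode_eq_neg hxs e1

/-! ### The rescaled equations as a fixed point problem. -/

/-- The speed correction determined by the real part of the first mode. -/
noncomputable def speedCorr (ε β : ℝ) (z : CircleFun) : ℝ := -(firstMode ε β z).re

/-- The leading-order solution. -/
noncomputable def leading (δ k : ℝ) : ℝ × CircleFun :=
  (δ * k / (18 * (invSymbol δ k 2).im), -((3 : ℂ) • solveLin δ k cosTwo))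

/-- The correction of relative size `ε` in the fixed point equation. -/
noncomputable def correction (δ k : ℝ) (p : ℝ × CircleFun) : ℝ × CircleFun :=
  ((18 * (invSymbol δ k 2).im)⁻¹ *
    (((-6 * p.1 : ℝ) : ℂ) * (invSymbol δ k 2 *
        coeff 2 (remainder (small k) (speedCorr (small k) p.1 p.2) p.1 p.2))
      + ((3 * (√p.1 * p.1) : ℝ) : ℂ) * coeff 1 (p.2 * p.2)).im,
    -solveLin δ k (remainder (small k) (speedCorr (small k) p.1 p.2) p.1 p.2))

lemma coeff_two_cosTwo : coeff 2 cosTwo = 1 := by rw [coeff_cosTwo]; norm_num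

lemma firstMode_im_eq {δ k β : ℝ} {N z : CircleFun}
    (h2 : coeff 2 z = -(3 * invSymbol δ k 2) - small k * (invSymbol δ k 2 * coeff 2 N)) :
    (firstMode (small k) β z).im = -(18 * β * (invSymbol δ k 2).im)
      + small k * (((-6 * β : ℝ) : ℂ) * (invSymbol δ k 2 * coeff 2 N)
        + ((3 * (√β * β) : ℝ) : ℂ) * coeff 1 (z * z)).im := by
  have : firstMode (small k) β z = ((-(18 * β) : ℝ) : ℂ) * invSymbol δ k 2
      + (small k : ℂ) * (((-6 * β : ℝ) : ℂ) * (invSymbol δ k 2 * coeff 2 N)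
        + ((3 * (√β * β) : ℝ) : ℂ) * coeff 1 (z * z)) := by
    rw [firstMode, h2]; push_cast; ring
  rw [this, Complex.add_im, Complex.im_ofReal_mul, Complex.im_ofReal_mul]; ring

/-- The first mode is one complex equation for two real unknowns. Its real part gives `b`; its
imaginary part, with `z_2` replaced by means of the second mode, is solved for `β` by dividing by
`18 (invSymbol δ k 2).im > 0`. -/
theorem ScaledModes.fixed {δ k b β : ℝ} (hδ : 0 < δ) (hk : Admissible k) {z : CircleFun}
    (h : ScaledModes δ k b β z) :
    b = speedCorr (small k) β z ∧
      (β, z) = leading δ k + small k • correction δ k (β, z) := by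
  have hb : b = speedCorr (small k) β z := by
    have := congrArg Complex.re h.first
    simp only [Complex.add_re, Complex.ofReal_re, Complex.I_mul_re, Complex.ofReal_im,
      Complex.zero_re] at this
    rw [speedCorr]; linarith
  refine ⟨hb, ?_⟩
  subst hb
  have hz : z = -((3 : ℂ) • solveLin δ k cosTwo) + small k •
      -solveLin δ k (remainder (small k) (speedCorr (small k) β z) β z) := by
    refine circleFun_ext fun n => ?_
    rw [← Complex.coe_smul, map_add, map_smul, map_neg, map_neg, map_smul, coeff_solveLin hk,
      coeff_solveLin hk, smul_eq_mul, smul_eq_mul]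
    by_cases hn : 2 ≤ |n|
    · have e := h.high n hn
      have hs := symbol_ne_zero (δ := δ) hk hn
      rw [invSymbol, if_pos hn]
      field_simp
      linear_combination e
    · rw [invSymbol, if_neg hn, h.low n (by omega)]; ring
  refine Prod.ext ?_ hz
  have h2 := congrArg (coeff 2) hz
  rw [← Complex.coe_smul, map_add, map_smul, map_neg, map_neg, map_smul, coeff_solveLin hk,
      coeff_solveLin hk, smul_eq_mul, smul_eq_mul, coeff_two_cosTwo] at h2
  have him := congrArg Complex.im h.first
  rw [Complex.add_im, Complex.add_im, Complex.ofReal_im, Complex.I_mul_im, Complex.ofReal_re,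
    Complex.zero_im, zero_add, firstMode_im_eq (h2.trans (by ring))] at him
  have hm : 0 < (invSymbol δ k 2).im :=
    lt_of_lt_of_le (by positivity) (invSymbol_two_im_lower hδ hk)
  simp only [leading, correction, Prod.fst_add, Prod.smul_fst, smul_eq_mul]
  generalize ((((-6 * β : ℝ) : ℂ) * (invSymbol δ k 2 * coeff 2
      (remainder (small k) (speedCorr (small k) β z) β z))
      + ((3 * (√β * β) : ℝ) : ℂ) * coeff 1 (z * z)).im) = t at him ⊢
  field_simp
  linear_combination -him

theorem scaledModes_of_fixed {δ k β : ℝ} (hδ : 0 < δ) (hk : Admissible k) {z : CircleFun}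
    (hs : star z = z) (h : (β, z) = leading δ k + small k • correction δ k (β, z)) :
    ScaledModes δ k (speedCorr (small k) β z) β z := by
  have hz := congrArg Prod.snd h
  have hβ := congrArg Prod.fst h
  simp only [leading, correction, Prod.fst_add, Prod.smul_fst, Prod.snd_add, Prod.smul_snd,
    smul_eq_mul] at hz hβ
  have hc : ∀ n, coeff n z = -(3 * (invSymbol δ k n * coeff n cosTwo)) - small k *
      (invSymbol δ k n * coeff n (remainder (small k) (speedCorr (small k) β z) β z)) := fun n => by
    have e := congrArg (coeff n) hz
    rw [← Complex.coe_smul, map_add, map_smul, map_neg, map_neg, map_smul, coeff_solveLin hk,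
      coeff_solveLin hk, smul_eq_mul, smul_eq_mul] at e
    exact e.trans (by ring)
  have hm : 0 < (invSymbol δ k 2).im :=
    lt_of_lt_of_le (by positivity) (invSymbol_two_im_lower hδ hk)
  refine ⟨hs, fun n hn => ?_, ?_, fun n hn => ?_⟩
  · rw [hc, invSymbol, if_neg (by omega)]; ring
  · have h2 := hc 2
    rw [coeff_two_cosTwo, mul_one] at h2
    apply Complex.ext
    · simp [speedCorr]
    · rw [Complex.add_im, Complex.add_im, Complex.ofReal_im, Complex.I_mul_im, Complex.ofReal_re,
        Complex.zero_im, zero_add, firstMode_im_eq h2]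
      generalize ((((-6 * β : ℝ) : ℂ) * (invSymbol δ k 2 * coeff 2
          (remainder (small k) (speedCorr (small k) β z) β z))
          + ((3 * (√β * β) : ℝ) : ℂ) * coeff 1 (z * z)).im) = t at hβ ⊢
      field_simp at hβ
      linear_combination -hβ
  · have hsy := symbol_ne_zero (δ := δ) hk hn
    rw [hc, invSymbol, if_pos hn]
    field_simp
    ring

/-! ### Calculus of uniformly bounded and Lipschitz families. -/

section UnifLip

variable {ι P E F G : Type*} [NormedAddCommGroup P] [NormedAddCommGroup E] [NormedAddCommGroup F]
  [NormedAddCommGroup G] {K : Set ι} {S : Set P}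

/-- A family of maps is bounded and Lipschitz on `S`, uniformly in the parameter `i ∈ K`. -/
def UnifLip (K : Set ι) (S : Set P) (f : ι → P → E) : Prop :=
  ∃ C, 0 ≤ C ∧ ∀ i ∈ K, ∀ p ∈ S, ‖f i p‖ ≤ C ∧ ∀ p' ∈ S, ‖f i p - f i p'‖ ≤ C * ‖p - p'‖

lemma unifLip_const {f : ι → E} {C : ℝ} (h : ∀ i ∈ K, ‖f i‖ ≤ C) :
    UnifLip K S fun i _ => f i :=
  ⟨max C 0, le_max_right _ _, fun i hi p _ => ⟨(h i hi).trans (le_max_left _ _), fun p' _ => by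
    rw [sub_self, norm_zero]; positivity⟩⟩

lemma UnifLip.add {f g : ι → P → E} (hf : UnifLip K S f) (hg : UnifLip K S g) :
    UnifLip K S fun i p => f i p + g i p := by
  obtain ⟨C, hC, hf⟩ := hf
  obtain ⟨D, hD, hg⟩ := hg
  refine ⟨C + D, add_nonneg hC hD, fun i hi p hp => ⟨?_, fun p' hp' => ?_⟩⟩
  · exact (norm_add_le _ _).trans (add_le_add (hf i hi p hp).1 (hg i hi p hp).1)
  · rw [add_sub_add_comm, add_mul]
    exact (norm_add_le _ _).trans (add_le_add ((hf i hi p hp).2 p' hp') ((hg i hi p hp).2 p' hp'))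

lemma UnifLip.map {f : ι → P → E} (hf : UnifLip K S f) (T : ι → E → F) {D : ℝ} (hD : 0 ≤ D)
    (hsub : ∀ i x y, T i (x - y) = T i x - T i y) (hT : ∀ i ∈ K, ∀ x, ‖T i x‖ ≤ D * ‖x‖) :
    UnifLip K S fun i p => T i (f i p) := by
  obtain ⟨C, hC, hf⟩ := hf
  refine ⟨D * C, by positivity, fun i hi p hp => ⟨?_, fun p' hp' => ?_⟩⟩
  · exact (hT i hi _).trans (by gcongr; exact (hf i hi p hp).1)
  · rw [← hsub, mul_assoc]
    exact (hT i hi _).trans (by gcongr; exact (hf i hi p hp).2 p' hp')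

lemma UnifLip.map₂ {f : ι → P → E} {g : ι → P → F} (hf : UnifLip K S f) (hg : UnifLip K S g)
    (B : E → F → G) (hl : ∀ x x' y, B (x - x') y = B x y - B x' y)
    (hr : ∀ x y y', B x (y - y') = B x y - B x y') (hB : ∀ x y, ‖B x y‖ ≤ ‖x‖ * ‖y‖) :
    UnifLip K S fun i p => B (f i p) (g i p) := by
  obtain ⟨C, hC, hf⟩ := hf
  obtain ⟨D, hD, hg⟩ := hg
  refine ⟨2 * (C * D), by positivity, fun i hi p hp => ⟨?_, fun p' hp' => ?_⟩⟩
  · calc _ ≤ ‖f i p‖ * ‖g i p‖ := hB _ _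
      _ ≤ C * D := by gcongr; exacts [(hf i hi p hp).1, (hg i hi p hp).1]
      _ ≤ _ := by nlinarith [mul_nonneg hC hD]
  · have e : B (f i p) (g i p) - B (f i p') (g i p')
        = B (f i p - f i p') (g i p) + B (f i p') (g i p - g i p') := by rw [hl, hr]; abel
    rw [e]
    calc _ ≤ ‖f i p - f i p'‖ * ‖g i p‖ + ‖f i p'‖ * ‖g i p - g i p'‖ :=
          (norm_add_le _ _).trans (add_le_add (hB _ _) (hB _ _))
      _ ≤ C * ‖p - p'‖ * D + C * (D * ‖p - p'‖) := by
          gcongr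
          exacts [(hf i hi p hp).2 p' hp', (hg i hi p hp).1, (hf i hi p' hp').1,
            (hg i hi p hp).2 p' hp']
      _ = _ := by ring

lemma UnifLip.mul {A : Type*} [NormedRing A] {f g : ι → P → A} (hf : UnifLip K S f)
    (hg : UnifLip K S g) : UnifLip K S fun i p => f i p * g i p :=
  hf.map₂ hg (· * ·) (fun _ _ _ => sub_mul _ _ _) (fun _ _ _ => mul_sub _ _ _) norm_mul_le

lemma UnifLip.smul [NormedSpace ℂ E] {f : ι → P → ℂ} {g : ι → P → E} (hf : UnifLip K S f)
    (hg : UnifLip K S g) : UnifLip K S fun i p => f i p • g i p :=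
  hf.map₂ hg (· • ·) (fun _ _ _ => sub_smul _ _ _) (fun _ _ _ => smul_sub _ _ _) norm_smul_le

lemma UnifLip.neg {f : ι → P → E} (hf : UnifLip K S f) : UnifLip K S fun i p => -f i p :=
  hf.map (fun _ x => -x) zero_le_one (fun _ _ _ => by abel) (fun _ _ _ => by simp)

lemma UnifLip.ofReal {f : ι → P → ℝ} (hf : UnifLip K S f) :
    UnifLip K S fun i p => ((f i p : ℝ) : ℂ) :=
  hf.map (fun _ x => (x : ℂ)) zero_le_one (fun _ _ _ => by simp) (fun _ _ _ => by simp)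

lemma UnifLip.re {f : ι → P → ℂ} (hf : UnifLip K S f) : UnifLip K S fun i p => (f i p).re :=
  hf.map (fun _ x => x.re) zero_le_one (fun _ _ _ => by simp)
    (fun _ _ x => by simpa using Complex.abs_re_le_norm x)

lemma UnifLip.im {f : ι → P → ℂ} (hf : UnifLip K S f) : UnifLip K S fun i p => (f i p).im :=
  hf.map (fun _ x => x.im) zero_le_one (fun _ _ _ => by simp)
    (fun _ _ x => by simpa using Complex.abs_im_le_norm x)

lemma UnifLip.prodMk {f : ι → P → E} {g : ι → P → F} (hf : UnifLip K S f) (hg : UnifLip K S g) :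
    UnifLip K S fun i p => (f i p, g i p) := by
  obtain ⟨C, hC, hf⟩ := hf
  obtain ⟨D, hD, hg⟩ := hg
  refine ⟨max C D, le_max_of_le_left hC, fun i hi p hp => ⟨?_, fun p' hp' => ?_⟩⟩
  · exact max_le_max (hf i hi p hp).1 (hg i hi p hp).1
  · rw [max_mul_of_nonneg _ _ (norm_nonneg _)]
    exact max_le_max ((hf i hi p hp).2 p' hp') ((hg i hi p hp).2 p' hp')

lemma UnifLip.sqrt {f : ι → P → ℝ} (hf : UnifLip K S f) {c : ℝ} (hc : 0 < c)
    (h : ∀ i ∈ K, ∀ p ∈ S, c ≤ f i p) : UnifLip K S fun i p => √(f i p) := by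
  obtain ⟨C, hC, hf⟩ := hf
  refine ⟨max √C ((√c)⁻¹ * C), le_max_of_le_left (Real.sqrt_nonneg _),
    fun i hi p hp => ⟨le_max_of_le_left ?_, fun p' hp' => ?_⟩⟩
  · rw [Real.norm_of_nonneg (Real.sqrt_nonneg _)]
    exact Real.sqrt_le_sqrt ((le_abs_self _).trans (hf i hi p hp).1)
  · have hsc : 0 < √c := Real.sqrt_pos.mpr hc
    have h1 : √c ≤ √(f i p) := Real.sqrt_le_sqrt (h i hi p hp)
    have h2 : 0 ≤ √(f i p') := Real.sqrt_nonneg _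
    have e : f i p - f i p' = (√(f i p) + √(f i p')) * (√(f i p) - √(f i p')) := by
      rw [← sq_sub_sq, Real.sq_sqrt (hc.le.trans (h i hi p hp)),
        Real.sq_sqrt (hc.le.trans (h i hi p' hp'))]
    have h3 := (hf i hi p hp).2 p' hp'
    rw [e, norm_mul, Real.norm_of_nonneg (by linarith)] at h3
    have h4 : √c * ‖√(f i p) - √(f i p')‖ ≤ C * ‖p - p'‖ :=
      le_trans (by gcongr; linarith) h3
    calc _ ≤ (√c)⁻¹ * C * ‖p - p'‖ := by
          rw [mul_assoc, inv_mul_eq_div, le_div_iff₀ hsc]; linarith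
      _ ≤ _ := by gcongr; exact le_max_right _ _

end UnifLip

/-! ### The contraction argument. -/

/-- The region in which the rescaled problem is solved. -/
def region (R : ℝ) : Set (ℝ × CircleFun) :=
  {p | R⁻¹ ≤ p.1 ∧ p.1 ≤ R ∧ ‖p.2‖ ≤ R ∧ star p.2 = p.2}

lemma isClosed_region (R : ℝ) : IsClosed (region R) :=
  (isClosed_le continuous_const continuous_fst).inter <|
    (isClosed_le continuous_fst continuous_const).inter <|
      (isClosed_le continuous_snd.norm continuous_const).inter <|
        isClosed_eq continuous_snd.star continuous_snd

theorem unifLip_correction {δ R : ℝ} (hδ : 0 < δ) (hR : 0 < R) :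
    UnifLip {k | Admissible k} (region R) (correction δ) := by
  have hε : UnifLip {k | Admissible k} (region R) fun k _ => small k :=
    unifLip_const (C := 1) fun k hk => by
      rw [Real.norm_of_nonneg hk.small_pos.le]; exact hk.small_le_one
  have hβ : UnifLip {k | Admissible k} (region R) fun _ p => p.1 :=
    ⟨max R 1, by positivity, fun k _ p hp => ⟨le_max_of_le_left ?_, fun p' _ =>
      (norm_fst_le (p - p')).trans (le_mul_of_one_le_left (norm_nonneg _) (le_max_right _ _))⟩⟩
  swap
  · rw [Real.norm_of_nonneg ((inv_pos.mpr hR).le.trans hp.1)]; exact hp.2.1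
  have hz : UnifLip {k | Admissible k} (region R) fun _ p => p.2 :=
    ⟨max R 1, by positivity, fun k _ p hp => ⟨le_max_of_le_left hp.2.2.1, fun p' _ =>
      (norm_snd_le (p - p')).trans (le_mul_of_one_le_left (norm_nonneg _) (le_max_right _ _))⟩⟩
  -- The bound `R⁻¹ ≤ β` on the region keeps the square root away from its singularity.
  have hα : UnifLip {k | Admissible k} (region R) fun _ p => √p.1 :=
    hβ.sqrt (inv_pos.mpr hR) fun k _ p hp => hp.1
  have hr : ∀ r : ℝ, UnifLip {k | Admissible k} (region R) fun _ _ => r := fun r =>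
    unifLip_const (C := ‖r‖) fun k _ => le_rfl
  have hcoeff : ∀ (n : ℤ) {f : ℝ → ℝ × CircleFun → CircleFun},
      UnifLip {k | Admissible k} (region R) f →
      UnifLip {k | Admissible k} (region R) fun k p => coeff n (f k p) := fun n f hf =>
    hf.map (fun _ x => coeff n x) zero_le_one (fun _ _ _ => map_sub _ _ _)
      (fun _ _ x => by rw [one_mul]; exact norm_coeff_le n x)
  have hfirst : UnifLip {k | Admissible k} (region R) fun k p => firstMode (small k) p.1 p.2 :=
    (((hr 6).mul hβ).ofReal.mul (hcoeff 2 hz)).add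
      ((((hr 3).mul hε).mul (hα.mul hβ)).ofReal.mul (hcoeff 1 (hz.mul hz)))
  have hspeed : UnifLip {k | Admissible k} (region R) fun k p => speedCorr (small k) p.1 p.2 :=
    hfirst.re.neg
  have hcos : UnifLip {k | Admissible k} (region R) fun _ _ => cosOne :=
    unifLip_const (C := ‖cosOne‖) fun k _ => le_rfl
  have hthree : UnifLip {k | Admissible k} (region R) fun _ _ => (3 : ℂ) :=
    unifLip_const (C := ‖(3 : ℂ)‖) fun k _ => le_rfl
  have hrem : UnifLip {k | Admissible k} (region R)
      fun k p => remainder (small k) (speedCorr (small k) p.1 p.2) p.1 p.2 :=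
    ((hε.mul hspeed).ofReal.smul hz).add (hthree.smul
      ((((hr 2).mul hα).ofReal.smul (hcos.mul hz)).add ((hε.mul hβ).ofReal.smul (hz.mul hz))))
  have hm : UnifLip {k | Admissible k} (region R) fun k _ => invSymbol δ k 2 :=
    unifLip_const (C := 1) fun k hk => norm_invSymbol_two_le hk
  have hminv : UnifLip {k | Admissible k} (region R) fun k _ => (18 * (invSymbol δ k 2).im)⁻¹ :=
    unifLip_const (C := (18 * (δ / (9 + 36 * δ ^ 2)))⁻¹) fun k hk => by
      have h1 := invSymbol_two_im_lower hδ hk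
      have h0 : 0 < δ / (9 + 36 * δ ^ 2) := by positivity
      rw [Real.norm_of_nonneg (by positivity [h0.trans_le h1])]
      gcongr
  exact (hminv.mul (((((hr (-6)).mul hβ).ofReal.mul (hm.mul (hcoeff 2 hrem))).add
    (((hr 3).mul (hα.mul hβ)).ofReal.mul (hcoeff 1 (hz.mul hz)))).im)).prodMk
    (hrem.map (fun k x => -solveLin δ k x) (D := ∑' n : ℤ, 4 * (1 / (n : ℝ) ^ 2))
      (tsum_nonneg fun n => by positivity) (fun _ _ _ => by rw [map_sub]; abel)
      (fun k hk x => by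
        rw [norm_neg]; exact (solveLin δ k).le_of_opNorm_le (norm_solveLin_le hk) x))

lemma star_remainder {ε b β : ℝ} {z : CircleFun} (hz : star z = z) :
    star (remainder ε b β z) = remainder ε b β z := by
  have h3 : (3 : ℂ) = ((3 : ℝ) : ℂ) := by norm_num
  simp only [remainder, h3, star_add, star_real_smul, star_mul, hz, star_cosOne, mul_comm z]

lemma star_leading {δ k : ℝ} (hk : Admissible k) : star (leading δ k).2 = (leading δ k).2 := by
  have h3 : (3 : ℂ) = ((3 : ℝ) : ℂ) := by norm_num
  simp only [leading, h3, star_neg, star_real_smul, star_solveLin hk, star_cosTwo]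

lemma star_correction {δ k : ℝ} (hk : Admissible k) {p : ℝ × CircleFun} (hp : star p.2 = p.2) :
    star (correction δ k p).2 = (correction δ k p).2 := by
  simp only [correction, star_neg, star_solveLin hk, star_remainder hp]

lemma leading_bounds {δ : ℝ} (hδ : 0 < δ) : ∃ R₀ : ℝ, 0 < R₀ ∧ ∀ k, Admissible k →
    R₀⁻¹ ≤ (leading δ k).1 ∧ (leading δ k).1 ≤ R₀ ∧ ‖(leading δ k).2‖ ≤ R₀ := by
  set T := ∑' n : ℤ, 4 * (1 / (n : ℝ) ^ 2)
  have hT : 0 ≤ T := tsum_nonneg fun n => by positivity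
  -- One summand for each requirement: the lower bound on `β`, the upper bound on `β`, the bound on
  -- `z`.
  refine ⟨36 / δ + (9 + 36 * δ ^ 2) / 18 + 6 * T, by positivity, fun k hk => ?_⟩
  have hm := invSymbol_two_im_lower hδ hk
  have hm0 : 0 < (invSymbol δ k 2).im := lt_of_lt_of_le (by positivity) hm
  have hm1 : (invSymbol δ k 2).im ≤ 1 :=
    (le_abs_self _).trans ((Complex.abs_im_le_norm _).trans (norm_invSymbol_two_le hk))
  refine ⟨?_, ?_, ?_⟩
  · calc _ ≤ (36 / δ)⁻¹ := by
          gcongr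
          have : 0 ≤ (9 + 36 * δ ^ 2) / 18 := by positivity
          linarith
      _ = δ * (1 / 2) / (18 * 1) := by field_simp; norm_num
      _ ≤ _ := by
          simp only [leading]
          have := hk.pos
          gcongr
          exact hk.half_le
  · have : (leading δ k).1 ≤ (9 + 36 * δ ^ 2) / 18 := by
      simp only [leading]
      calc _ ≤ δ * 1 / (18 * (δ / (9 + 36 * δ ^ 2))) := by
            gcongr; exact hk.lt_one.le
        _ = _ := by field_simp
    have : 0 < 36 / δ := by positivity
    linarith
  · have : ‖(leading δ k).2‖ ≤ 6 * T := by
      simp only [leading]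
      rw [norm_neg, norm_smul]
      calc _ ≤ ‖(3 : ℂ)‖ * (T * 2) := by
            gcongr
            exact ((solveLin δ k).le_of_opNorm_le (norm_solveLin_le hk) _).trans
              (mul_le_mul_of_nonneg_left norm_cosTwo_le hT)
        _ = _ := by norm_num; ring
    have : 0 < 36 / δ := by positivity
    have : 0 < (9 + 36 * δ ^ 2) / 18 := by positivity
    linarith

/-- Every large `R` is allowed, with `ε₀` depending on `R`, so that the region can later be enlarged
to contain all waves given by the a priori bounds. -/
theorem exists_unique_fixed {δ : ℝ} (hδ : 0 < δ) : ∃ R₀ : ℝ, 0 < R₀ ∧ ∀ R, R₀ ≤ R →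
    ∃ ε₀ > 0, ∀ k, Admissible k → small k < ε₀ →
      ∃ p ∈ region R, p = leading δ k + small k • correction δ k p ∧
        ∀ p' ∈ region R, p' = leading δ k + small k • correction δ k p' → p' = p := by
  obtain ⟨R₀, hR₀, hlead⟩ := leading_bounds hδ
  -- Doubling leaves room for a correction of size at most `R₀` above and `R₀⁻¹ / 2` below.
  refine ⟨2 * R₀, by positivity, fun R hR => ?_⟩
  have hRpos : 0 < R := by linarith
  obtain ⟨C, hC, hcorr⟩ := unifLip_correction hδ hRpos
  refine ⟨min ((2 * (C + 1))⁻¹) (min (R₀ / (C + 1)) (R₀⁻¹ / 2 / (C + 1))),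
    lt_min (by positivity) (lt_min (by positivity) (by positivity)), fun k hk hsm => ?_⟩
  have hε := hk.small_pos
  obtain ⟨s1, s2⟩ := lt_min_iff.mp hsm
  obtain ⟨s2, s3⟩ := lt_min_iff.mp s2
  rw [lt_inv_comm₀ hε (by positivity)] at s1
  have t1 : small k * C ≤ 1 / 2 := by
    have := mul_lt_mul_of_pos_left s1 hε
    rw [mul_inv_cancel₀ hε.ne'] at this
    nlinarith
  rw [lt_div_iff₀ (by positivity)] at s2 s3
  have t2 : small k * C ≤ R₀ := by nlinarith
  have t3 : small k * C ≤ R₀⁻¹ / 2 := by nlinarith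
  set Φ : ℝ × CircleFun → ℝ × CircleFun := fun p => leading δ k + small k • correction δ k p
    with hΦ
  have hlip : ∀ p ∈ region R, ∀ p' ∈ region R, ‖Φ p - Φ p'‖ ≤ 1 / 2 * ‖p - p'‖ :=
    fun p hp p' hp' => by
      have := (hcorr k hk p hp).2 p' hp'
      simp only [hΦ]
      rw [add_sub_add_left_eq_sub, ← smul_sub, norm_smul, Real.norm_of_nonneg hε.le]
      calc _ ≤ small k * (C * ‖p - p'‖) := by gcongr
        _ = small k * C * ‖p - p'‖ := by ring
        _ ≤ _ := by gcongr
  have hmaps : Set.MapsTo Φ (region R) (region R) := fun p hp => by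
    have hn : ‖small k • correction δ k p‖ ≤ small k * C := by
      rw [norm_smul, Real.norm_of_nonneg hε.le]
      gcongr
      exact (hcorr k hk p hp).1
    obtain ⟨l1, l2, l3⟩ := hlead k hk
    have n1 := abs_le.mp ((norm_fst_le (small k • correction δ k p)).trans hn)
    have n2 := (norm_snd_le (small k • correction δ k p)).trans hn
    have hRinv : R⁻¹ ≤ R₀⁻¹ / 2 := by
      rw [div_eq_mul_inv, ← mul_inv]
      gcongr
      linarith
    refine ⟨?_, ?_, ?_, ?_⟩
    · simp only [hΦ, Prod.fst_add]; linarith [n1.1]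
    · simp only [hΦ, Prod.fst_add]; linarith [n1.2]
    · simp only [hΦ, Prod.snd_add]
      exact (norm_add_le _ _).trans (by linarith)
    · simp only [hΦ, Prod.snd_add, Prod.smul_snd, star_add, star_leading hk]
      rw [← Complex.coe_smul, star_real_smul, star_correction hk hp.2.2.2]
  have hcontr : ContractingWith (1 / 2) (hmaps.restrict Φ (region R) (region R)) := by
    refine ⟨by norm_num, LipschitzWith.of_dist_le_mul fun p p' => ?_⟩
    have := hlip p p.2 p' p'.2
    rw [Subtype.dist_eq, Subtype.dist_eq, dist_eq_norm, dist_eq_norm]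
    simpa using this
  have hne : leading δ k ∈ region R := by
    obtain ⟨l1, l2, l3⟩ := hlead k hk
    refine ⟨(inv_anti₀ hR₀ (by linarith)).trans l1, by linarith, by linarith, star_leading hk⟩
  obtain ⟨p, hp, hfix, -⟩ := hcontr.exists_fixedPoint' (isClosed_region R).isComplete hmaps hne
    (edist_ne_top _ _)
  refine ⟨p, hp, hfix.symm, fun p' hp' hfix' => ?_⟩
  have h := hlip p' hp' p hp
  rw [show Φ p' = p' from hfix'.symm, show Φ p = p from hfix] at h
  have : ‖p' - p‖ = 0 := le_antisymm (by linarith) (norm_nonneg _)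
  exact sub_eq_zero.mp (norm_eq_zero.mp this)

/-! ### A priori bounds for waves of arbitrary amplitude. -/

/-- The part of a function beyond the modes `±1` of amplitude `A`. -/
noncomputable def higher (A : ℝ) (x : CircleFun) : CircleFun := x - (A : ℂ) • cosOne

/-- A solution of the mode equations, translated so that its first mode is positive, together with
its energy balance. -/
structure NormalizedSolution (δ k a A : ℝ) (x : CircleFun) : Prop extends SolvesModes δ k a x where
  amplitude_pos : 0 < A
  coeff_one : coeff 1 x = A
  energy : HasSum (fun n : ℤ => (n : ℝ) ^ 2 * (k ^ 2 * n ^ 2 - 1) * ‖coeff n x‖ ^ 2) 0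

variable {δ k a A : ℝ} {x : CircleFun}

lemma NormalizedSolution.coeff_neg_one (h : NormalizedSolution δ k a A x) : coeff (-1) x = A := by
  rw [coeff_neg_of_star_eq h.star_eq, h.coeff_one, Complex.conj_ofReal]

lemma NormalizedSolution.coeff_higher_low (h : NormalizedSolution δ k a A x) {n : ℤ}
    (hn : |n| ≤ 1) : coeff n (higher A x) = 0 := by
  rw [higher, map_sub, map_smul, coeff_cosOne]
  have : n = 0 ∨ n = 1 ∨ n = -1 := by rcases abs_cases n with h | h <;> omega
  rcases this with rfl | rfl | rfl
  · simp [h.coeff_zero]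
  · simp [h.coeff_one]
  · simp [h.coeff_neg_one]

lemma coeff_higher_high {n : ℤ} (hn : 2 ≤ |n|) : coeff n (higher A x) = coeff n x := by
  rw [higher, map_sub, map_smul, coeff_cosOne, if_neg (by rintro rfl; norm_num at hn),
    if_neg (by rintro rfl; norm_num at hn)]
  simp

lemma sq_eq_higher (A : ℝ) (x : CircleFun) : x * x = ((A ^ 2 : ℝ) : ℂ) • cosTwo
    + ((2 * A ^ 2 : ℝ) : ℂ) • (1 : CircleFun) + ((2 * A : ℝ) : ℂ) • (cosOne * higher A x)
      + higher A x * higher A x := by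
  have h : x * x = ((A ^ 2 : ℝ) : ℂ) • (cosOne * cosOne)
      + ((2 * A : ℝ) : ℂ) • (cosOne * higher A x) + higher A x * higher A x := by
    ext t
    simp only [higher, ContinuousMap.add_apply, ContinuousMap.smul_apply, ContinuousMap.sub_apply,
      ContinuousMap.mul_apply, smul_eq_mul]
    push_cast; ring
  rw [h, cosOne_mul_cosOne, smul_add, smul_smul]
  push_cast
  congr 4
  ring

/-- By the energy balance the modes `|n| ≥ 2` have weighted square sum exactly `2 (εA)²`. Since the
weights grow like `n⁴`, this controls the sum of `|x_n|`, hence the sup norm, with no smallness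
assumption on `A`. -/
theorem NormalizedSolution.norm_higher_le (hk : Admissible k) (h : NormalizedSolution δ k a A x) :
    ‖higher A x‖ ≤ ((∑' n : ℤ, 1 / (n : ℝ) ^ 2) / 2 + 4) * (small k * A) := by
  have hA := h.amplitude_pos
  have hε := hk.small_pos
  set t := small k * A with ht
  have htpos : 0 < t := mul_pos hε hA
  -- Adding `t²` at `n = ±1` cancels the two negative terms; all `g n` are then nonnegative, with
  -- sum `2t²`.
  have hg := (h.energy.add (hasSum_ite_eq (1 : ℤ) (t ^ 2))).add (hasSum_ite_eq (-1 : ℤ) (t ^ 2))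
  set g : ℤ → ℝ := fun n => (n : ℝ) ^ 2 * (k ^ 2 * n ^ 2 - 1) * ‖coeff n x‖ ^ 2
    + (if n = 1 then t ^ 2 else 0) + (if n = -1 then t ^ 2 else 0) with hgdef
  have hS : HasSum (fun n : ℤ => 1 / (n : ℝ) ^ 2) (∑' n : ℤ, 1 / (n : ℝ) ^ 2) :=
    (Real.summable_one_div_int_pow.mpr one_lt_two).hasSum
  have hsum := ((hS.mul_left t).add (hg.mul_left (4 / t))).div_const 2
  have hterm : ∀ n : ℤ, ‖coeff n (higher A x)‖ ≤ (t * (1 / (n : ℝ) ^ 2) + 4 / t * g n) / 2 := by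
    intro n
    by_cases hn : 2 ≤ |n|
    · have h4 := four_le_sq_of_two_le_abs hn
      rw [coeff_higher_high hn]
      have hgn : (n : ℝ) ^ 4 / 4 * ‖coeff n x‖ ^ 2 ≤ g n := by
        rw [hgdef]
        simp only
        rw [if_neg (by rintro rfl; norm_num at hn), if_neg (by rintro rfl; norm_num at hn),
          add_zero, add_zero]
        gcongr
        have : (n : ℝ) ^ 2 / 4 ≤ k ^ 2 * n ^ 2 - 1 := by nlinarith [hk.half_le_sq]
        calc _ = (n : ℝ) ^ 2 * ((n : ℝ) ^ 2 / 4) := by ring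
          _ ≤ _ := by gcongr
      set y := ‖coeff n x‖
      set m := (n : ℝ) ^ 2
      have hm : (n : ℝ) ^ 4 = m ^ 2 := by simp only [m]; ring
      rw [hm] at hgn
      have hmpos : 0 < m := by linarith
      have h1 : m ^ 2 * y ^ 2 / t ≤ 4 / t * g n := by
        rw [div_mul_eq_mul_div]
        exact div_le_div_of_nonneg_right (by linarith) htpos.le
      -- Arithmetic–geometric mean inequality, in place of Cauchy–Schwarz for the series.
      have h2 : 2 * y ≤ t * (1 / m) + m ^ 2 * y ^ 2 / t := by
        have h3 : 2 * y ≤ t * (1 / m) + m * y ^ 2 / t := by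
          have : t * (1 / m) + m * y ^ 2 / t - 2 * y = (t - m * y) ^ 2 / (t * m) := by
            field_simp; ring
          have : 0 ≤ (t - m * y) ^ 2 / (t * m) := by positivity
          linarith
        have : m * y ^ 2 / t ≤ m ^ 2 * y ^ 2 / t := by gcongr; nlinarith
        linarith
      linarith
    · have hn' : |n| ≤ 1 := by omega
      rw [h.coeff_higher_low hn', norm_zero]
      have hg0 : 0 ≤ g n := by
        have : n = 0 ∨ n = 1 ∨ n = -1 := by rcases abs_cases n with h | h <;> omega
        have e : t ^ 2 = (1 - k ^ 2) * A ^ 2 := by rw [ht, mul_pow, hk.small_sq]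
        rcases this with rfl | rfl | rfl
        · simp [hgdef]
        · simp [hgdef, h.coeff_one, e]; linarith
        · simp [hgdef, h.coeff_neg_one, e]; linarith
      positivity
  have hs : Summable fun n => ‖coeff n (higher A x)‖ :=
    .of_nonneg_of_le (fun _ => norm_nonneg _) hterm hsum.summable
  have h1 : ‖higher A x‖ ≤ _ :=
    (summable_coeff_hasSum hs.of_norm).norm_le_of_bounded hsum fun n => by
      rw [norm_smul, fourier_norm, mul_one]; exact hterm n
  refine h1.trans (le_of_eq ?_)
  field_simp
  ring

lemma norm_mul_self_le (w : CircleFun) : ‖w * w‖ ≤ ‖w‖ ^ 2 := by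
  rw [sq]; exact norm_mul_le _ _

/-- The square of the fundamental has only modes `0, ±2`, so every quadratic term in mode 1 contains
the higher part. -/
theorem NormalizedSolution.first_bound (h : NormalizedSolution δ k a A x) :
    ‖symbol δ k a 1‖ * A ≤ 6 * A * ‖higher A x‖ + 3 * ‖higher A x‖ ^ 2 := by
  have hA := h.amplitude_pos
  have e := h.mode_eq 1 one_ne_zero
  rw [sq_eq_higher A x, h.coeff_one] at e
  simp only [map_add, map_smul, smul_eq_mul, coeff_cosOne_mul, coeff_cosTwo,
    WaveTrain.coeff_one] at e
  norm_num at e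
  rw [h.coeff_higher_low (by norm_num), zero_add] at e
  have e' : symbol δ k a 1 * A = -((6 * A : ℝ) * coeff 2 (higher A x)
      + 3 * coeff 1 (higher A x * higher A x)) := by
    push_cast; linear_combination e
  have := congrArg norm e'
  rw [norm_mul, Complex.norm_real, Real.norm_of_nonneg hA.le, norm_neg] at this
  rw [this]
  refine (norm_add_le _ _).trans ?_
  rw [norm_mul, norm_mul, Complex.norm_real, Real.norm_of_nonneg (by positivity)]
  norm_num
  gcongr
  · exact norm_coeff_le _ _
  · exact (norm_coeff_le _ _).trans (norm_mul_self_le _)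

/-- The fundamental forces mode 2 with strength `3A²`, and only terms containing the higher part can
balance it. -/
theorem NormalizedSolution.second_bound (h : NormalizedSolution δ k a A x) :
    3 * A ^ 2 ≤ ‖symbol δ k a 2‖ * ‖higher A x‖ + 6 * A * ‖higher A x‖ + 3 * ‖higher A x‖ ^ 2 := by
  have hA := h.amplitude_pos
  have e := h.mode_eq 2 two_ne_zero
  rw [sq_eq_higher A x, ← coeff_higher_high (A := A) (x := x) (n := 2) (by norm_num)] at e
  simp only [map_add, map_smul, smul_eq_mul, coeff_cosOne_mul, coeff_cosTwo,
    WaveTrain.coeff_one] at e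
  norm_num at e
  rw [h.coeff_higher_low (n := 1) (by norm_num), zero_add] at e
  have e' : ((3 * A ^ 2 : ℝ) : ℂ) = -(symbol δ k a 2 * coeff 2 (higher A x)
      + (6 * A : ℝ) * coeff 3 (higher A x) + 3 * coeff 2 (higher A x * higher A x)) := by
    push_cast; linear_combination e
  have := congrArg norm e'
  rw [Complex.norm_real, Real.norm_of_nonneg (by positivity), norm_neg] at this
  rw [this]
  refine (norm_add₃_le).trans ?_
  rw [norm_mul, norm_mul, norm_mul, Complex.norm_real, Real.norm_of_nonneg (by positivity)]
  norm_num
  gcongr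
  · exact norm_coeff_le _ _
  · exact norm_coeff_le _ _
  · exact (norm_coeff_le _ _).trans (norm_mul_self_le _)

/-- Inverts the symbol at `a = k²` and treats the detuning `a - k²` as a perturbation. Once detuning
and amplitude are small, the bound `O(εA)` improves to `O(A²)`. -/
theorem NormalizedSolution.higher_bound (hk : Admissible k) (h : NormalizedSolution δ k a A x) :
    ‖higher A x‖ ≤ (∑' n : ℤ, 4 * (1 / (n : ℝ) ^ 2)) * (|a - k ^ 2| * ‖higher A x‖
      + 3 * (2 * A ^ 2 + 4 * A * ‖higher A x‖ + ‖higher A x‖ ^ 2)) := by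
  have hA := h.amplitude_pos
  set w := higher A x with hw
  have e : w = -solveLin δ k (((a - k ^ 2 : ℝ) : ℂ) • w + (3 : ℂ) • (((A ^ 2 : ℝ) : ℂ) • cosTwo
      + ((2 * A : ℝ) : ℂ) • (cosOne * w) + w * w)) := by
    refine circleFun_ext fun n => ?_
    rw [map_neg, coeff_solveLin hk]
    by_cases hn : 2 ≤ |n|
    · have e := h.mode_eq n (by rintro rfl; norm_num at hn)
      have hs := symbol_ne_zero (δ := δ) hk hn
      rw [sq_eq_higher A x, ← coeff_higher_high (A := A) (x := x) hn, ← hw] at e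
      have hsym : symbol δ k a n = symbol δ k (k ^ 2) n + (a - k ^ 2 : ℝ) := by
        rw [symbol, symbol]; push_cast; ring
      simp only [map_add, map_smul, smul_eq_mul, WaveTrain.coeff_one, hsym] at e ⊢
      rw [if_neg (by rintro rfl; norm_num at hn)] at e
      rw [invSymbol, if_pos hn]
      push_cast at e ⊢
      field_simp
      linear_combination e
    · rw [hw, h.coeff_higher_low (by omega), invSymbol, if_neg hn]; ring
  have hT : 0 ≤ ∑' n : ℤ, 4 * (1 / (n : ℝ) ^ 2) := tsum_nonneg fun n => by positivity
  calc ‖w‖ = _ := by rw [congrArg norm e, norm_neg]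
    _ ≤ _ := (solveLin δ k).le_of_opNorm_le (norm_solveLin_le hk) _
    _ ≤ _ := by
      gcongr
      refine (norm_add_le _ _).trans ?_
      rw [norm_smul, norm_smul, Complex.norm_real, Real.norm_eq_abs]
      have h3 : ‖(3 : ℂ)‖ = 3 := by norm_num
      rw [h3]
      gcongr
      refine (norm_add₃_le).trans ?_
      rw [norm_smul, norm_smul, Complex.norm_real, Complex.norm_real,
        Real.norm_of_nonneg (by positivity), Real.norm_of_nonneg (by positivity)]
      have c1 := norm_cosTwo_le
      have c2 := norm_cosOne_le
      refine add_le_add (add_le_add ?_ ?_) ?_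
      · rw [mul_comm (2 : ℝ) (A ^ 2)]; gcongr
      · calc _ ≤ 2 * A * (2 * ‖w‖) := by
              gcongr; exact (norm_mul_le _ _).trans (by gcongr)
          _ = _ := by ring
      · exact norm_mul_self_le _

/-- The numerical part of the a priori bound. -/
lemma amplitude_bounds {δ c T : ℝ} (hδ : 0 < δ) (hc : 0 < c) (hT : 0 < T) :
    ∃ R > 0, ∃ ε₁ > 0, ∀ k ε s A W σ₁ σ₂ : ℝ, 0 < ε → ε ≤ 1 → ε < ε₁ → 1 / 2 ≤ k → 0 < A → 0 ≤ W →
      0 ≤ s → s ≤ σ₁ → δ * k * ε ^ 2 ≤ σ₁ → σ₂ ≤ s + 3 + 6 * δ → W ≤ c * (ε * A) →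
      σ₁ * A ≤ 6 * A * W + 3 * W ^ 2 →
      3 * A ^ 2 ≤ σ₂ * W + 6 * A * W + 3 * W ^ 2 →
      W ≤ T * (s * W + 3 * (2 * A ^ 2 + 4 * A * W + W ^ 2)) →
      ε ^ 2 ≤ R * A ^ 2 ∧ A ^ 2 ≤ R * ε ^ 2 ∧ W ≤ R * A ^ 2 := by
  set c₂ := 6 + 3 * c with hc₂
  set c₃ := 1 + 2 * δ with hc₃
  set c₄ := (c₂ / 3 + 1) * c + 2 with hc₄
  set d := 2 * c * c₃ with hd
  set c₆ := (c₂ + 3) * (c * d) + 12 * d with hc₆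
  have hc₂p : 0 < c₂ := by positivity
  have hc₃p : 0 < c₃ := by positivity
  have hc₄p : 0 < c₄ := by positivity
  have hdp : 0 < d := by positivity
  have hc₆p : 0 < c₆ := by positivity
  refine ⟨24 * c₂ * T / δ + d ^ 2 + 12 * T, by positivity,
    min (1 / (2 * (c * c₄))) (1 / (2 * (T * c₆))), lt_min (by positivity) (by positivity), ?_⟩
  intro k ε s A W σ₁ σ₂ hε hε1 hε₁ hk hA hW hs hsσ hδσ hσ₂ h0 h1 h2 h3
  obtain ⟨s1, s2⟩ := lt_min_iff.mp hε₁
  rw [lt_div_iff₀ (by positivity)] at s1 s2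
  have hWA : W ≤ c * A := h0.trans (by
    gcongr
    exact mul_le_of_le_one_left hA.le hε1)
  -- Mode 1 bounds the detuning by the higher part.
  have hσ₁ : σ₁ ≤ c₂ * W := by
    refine le_of_mul_le_mul_right (h1.trans ?_) hA
    have : W ^ 2 ≤ c * A * W := by rw [sq]; gcongr
    rw [hc₂]; linarith
  -- Mode 2 combined with `W ≤ cεA`; for small `ε` the term with `c₄ A` is absorbed on the left, so
  -- that `A ≤ dε`.
  have hA1 : A ≤ c * ε * (c₃ + c₄ * A) := by
    refine le_of_mul_le_mul_right ?_ hA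
    have e1 : σ₂ * W ≤ (c₂ * (c * A) + 3 + 6 * δ) * W := by
      gcongr
      have := mul_le_mul_of_nonneg_left hWA hc₂p.le
      linarith
    have e2 : W ^ 2 ≤ c * A * W := by rw [sq]; gcongr
    have e3 : A ^ 2 ≤ W * (c₃ + c₄ * A) := by
      rw [hc₃, hc₄]; linarith
    calc A * A = A ^ 2 := (sq A).symm
      _ ≤ _ := e3
      _ ≤ c * (ε * A) * (c₃ + c₄ * A) := by gcongr
      _ = _ := by ring
  have hAd : A ≤ d * ε := by
    have : c * ε * (c₄ * A) ≤ A / 2 := by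
      have := mul_lt_mul_of_pos_right s1 hA
      linarith
    rw [hd]
    linarith
  have hWd : W ≤ c * d * ε ^ 2 := h0.trans (by
    calc _ ≤ c * (ε * (d * ε)) := by gcongr
      _ = _ := by ring)
  have hWd' : W ≤ c * d * ε := hWd.trans (by
    gcongr
    exact pow_le_of_le_one hε.le hε1 two_ne_zero)
  -- Every term linear in `W` now has a factor `ε` and is absorbed, leaving only the forcing by
  -- `A²`.
  have hWT : W ≤ 12 * T * A ^ 2 := by
    have e1 : s * W + 3 * (2 * A ^ 2 + 4 * A * W + W ^ 2) ≤ c₆ * ε * W + 6 * A ^ 2 := by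
      have : (s + 12 * A + 3 * W) * W ≤ c₆ * ε * W := by
        gcongr
        have := mul_le_mul_of_nonneg_left hWd' (by positivity : 0 ≤ c₂ + 3)
        rw [hc₆]
        linarith
      linarith
    have e2 := mul_le_mul_of_nonneg_left e1 hT.le
    have e3 : T * (c₆ * ε * W) ≤ W / 2 := by
      have := mul_le_mul_of_nonneg_right s2.le hW
      linarith
    linarith
  have hA2 : 0 < A ^ 2 := by positivity
  have hε2 : 0 < ε ^ 2 := by positivity
  have p1 : 0 < 24 * c₂ * T / δ := by positivity
  have p2 : 0 < d ^ 2 := by positivity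
  refine ⟨?_, ?_, ?_⟩
  -- The amplitude cannot be much smaller than `ε`: the growth rate `δkε²` in mode 1 has to be
  -- balanced by `W = O(A²)`.
  · have e1 : δ * (1 / 2) * ε ^ 2 ≤ c₂ * (12 * T * A ^ 2) :=
      calc _ ≤ δ * k * ε ^ 2 := by gcongr
        _ ≤ σ₁ := hδσ
        _ ≤ c₂ * W := hσ₁
        _ ≤ _ := by gcongr
    have e2 : ε ^ 2 ≤ 24 * c₂ * T / δ * A ^ 2 := by
      rw [div_mul_eq_mul_div, le_div_iff₀ hδ]; linarith
    refine e2.trans ?_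
    gcongr
    linarith
  · calc A ^ 2 ≤ (d * ε) ^ 2 := by gcongr
      _ = d ^ 2 * ε ^ 2 := by ring
      _ ≤ _ := by gcongr; linarith
  · refine hWT.trans ?_
    gcongr
    linarith

theorem exists_scaledModes {δ : ℝ} (hδ : 0 < δ) : ∃ R > 0, ∃ ε₁ > 0, ∀ k, Admissible k →
    small k < ε₁ → ∀ a A x, NormalizedSolution δ k a A x →
      ∃ b β z, (β, z) ∈ region R ∧ ScaledModes δ k b β z ∧ a = k ^ 2 + small k ^ 2 * b ∧
        x = profile (small k * √β) z := by
  have hS : 0 ≤ ∑' n : ℤ, 1 / (n : ℝ) ^ 2 := tsum_nonneg fun n => by positivity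
  have hT : 0 < ∑' n : ℤ, 4 * (1 / (n : ℝ) ^ 2) :=
    summable_four_div_sq.tsum_pos (fun n => by positivity) 1 (by norm_num)
  obtain ⟨R, hR, ε₁, hε₁, H⟩ := amplitude_bounds hδ
    (c := (∑' n : ℤ, 1 / (n : ℝ) ^ 2) / 2 + 4) (by positivity) hT
  refine ⟨R, hR, ε₁, hε₁, fun k hk hkε a A x h => ?_⟩
  have hA := h.amplitude_pos
  have hε := hk.small_pos
  have hk1 := hk.lt_one
  have hk0 := hk.pos
  set ε := small k with hεdef
  have hsym1 : δ * k * ε ^ 2 ≤ ‖symbol δ k a 1‖ := by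
    refine le_trans (le_abs_self _) (le_trans (le_of_eq ?_) (Complex.abs_im_le_norm _))
    rw [symbol_im, hk.small_sq]; push_cast; ring_nf
  have hsym1' : |a - k ^ 2| ≤ ‖symbol δ k a 1‖ := by
    refine le_trans (le_of_eq ?_) (Complex.abs_re_le_norm _)
    rw [symbol_re]; push_cast; ring_nf
  have hsym2 : ‖symbol δ k a 2‖ ≤ |a - k ^ 2| + 3 + 6 * δ := by
    refine (Complex.norm_le_abs_re_add_abs_im _).trans ?_
    rw [symbol_re, symbol_im]
    push_cast
    have h1 := hk.half_le_sq
    have h2 := hk.sq_lt_one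
    have e1 : |a - k ^ 2 * 2 ^ 2| ≤ |a - k ^ 2| + 3 := by
      calc _ = |(a - k ^ 2) + -(3 * k ^ 2)| := by ring_nf
        _ ≤ |a - k ^ 2| + |-(3 * k ^ 2)| := abs_add_le _ _
        _ ≤ _ := by
          gcongr
          rw [abs_neg, abs_of_nonneg (by positivity)]
          linarith
    have e2 : |δ * k * 2 * (1 - k ^ 2 * 2 ^ 2)| ≤ 6 * δ := by
      rw [abs_mul, abs_of_nonneg (by positivity)]
      have : |1 - k ^ 2 * 2 ^ 2| ≤ 3 := abs_le.mpr ⟨by linarith, by linarith⟩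
      calc _ ≤ δ * 1 * 2 * 3 := by gcongr
        _ = _ := by ring
    linarith
  obtain ⟨b1, b2, b3⟩ := H k ε |a - k ^ 2| A ‖higher A x‖ _ _ hε hk.small_le_one hkε
    hk.half_le hA (norm_nonneg _) (abs_nonneg _) hsym1' hsym1 hsym2 (h.norm_higher_le hk)
    h.first_bound h.second_bound (h.higher_bound hk)
  have hβ : 0 < (A / ε) ^ 2 := by positivity
  have hsqrt : ε * √((A / ε) ^ 2) = A := by
    rw [Real.sqrt_sq (by positivity)]; field_simp
  have hx : x = profile A (((A ^ 2)⁻¹ : ℝ) • higher A x) := by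
    have hAc : (A : ℂ) ≠ 0 := by exact_mod_cast hA.ne'
    rw [profile, ← Complex.coe_smul, smul_smul, higher]
    push_cast
    rw [mul_inv_cancel₀ (pow_ne_zero 2 hAc), one_smul]
    abel
  have hstar : star (higher A x) = higher A x := by
    rw [higher, star_sub, star_real_smul, star_cosOne, h.star_eq]
  have hzs : star (((A ^ 2)⁻¹ : ℝ) • higher A x) = ((A ^ 2)⁻¹ : ℝ) • higher A x := by
    rw [← Complex.coe_smul, star_real_smul, hstar]
  refine ⟨(a - k ^ 2) / ε ^ 2, (A / ε) ^ 2, ((A ^ 2)⁻¹ : ℝ) • higher A x, ⟨?_, ?_, ?_, hzs⟩,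
    ?_, ?_, ?_⟩
  · rw [div_pow, le_div_iff₀ (by positivity), inv_mul_le_iff₀ hR]; exact b1
  · rw [div_pow, div_le_iff₀ (by positivity)]; exact b2
  · rw [norm_smul, Real.norm_of_nonneg (by positivity), inv_mul_le_iff₀ (by positivity)]
    linarith
  · refine (solvesModes_profile_iff hk hβ hzs fun n hn => ?_).mp ?_
    · rw [← Complex.coe_smul, map_smul, h.coeff_higher_low hn, smul_zero]
    · rw [← hεdef, hsqrt, ← hx]
      convert h.toSolvesModes using 1
      field_simp
      ring
  · field_simp
    ring
  · rw [hsqrt]; exact hx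

/-! ### Translation to a positive first mode. -/

theorem _root_.IsWaveTrain.translate {δ k M c q : ℝ} {V : ℝ → ℝ} (h : IsWaveTrain δ k M c q V) (s : ℝ) :
    IsWaveTrain δ k M c q (fun y => V (y + s)) := by
  refine ⟨h.contDiff.comp (contDiff_id.add contDiff_const), fun y => ?_, ?_, fun y => ?_, ?_⟩
  · rw [add_right_comm]; exact h.periodic _
  · obtain ⟨x, y, hxy⟩ := h.nonconstant
    exact ⟨x - s, y - s, by simpa using hxy⟩
  · rw [deriv_comp_add_const, iteratedDeriv_comp_add_const, iteratedDeriv_comp_add_const]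
    exact h.profile_eq (y + s)
  · rw [← h.mean_eq, periodMean, periodMean, intervalIntegral.integral_comp_add_right, zero_add,
      add_comm (2 * π) s, h.periodic.intervalIntegral_add_eq s 0, zero_add]

lemma coeff_translate {F G : CircleFun} {s : ℝ} (h : ∀ y : ℝ, G y = F ((y + s : ℝ))) (n : ℤ) :
    coeff n G = (fourier n : CircleFun) s * coeff n F := by
  have hG : ∀ t : AddCircle (2 * π), G t = F (t + s) := fun t => by
    induction t using QuotientAddGroup.induction_on with
    | H y => exact h y
  rw [coeff_apply, coeff_apply, fourierCoeff, fourierCoeff,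
    ← integral_add_right_eq_self (fun t => fourier (-n) t • F t) (s : AddCircle (2 * π)),
    ← integral_const_mul]
  congr 1; ext t
  have e : (fourier n : CircleFun) s * fourier (-n) (s : AddCircle (2 * π)) = 1 := by
    rw [← fourier_add, add_neg_cancel, fourier_zero]
  have e2 : fourier (-n) (t + s : AddCircle (2 * π))
      = fourier (-n) t * fourier (-n) (s : AddCircle (2 * π)) := by
    rw [fourier_apply, smul_add, AddCircle.toCircle_add, Circle.coe_mul]; rfl
  rw [hG, e2, smul_eq_mul, smul_eq_mul]
  linear_combination (-(fourier (-n) t * F (t + s))) * e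

/-- Without the modes `±1` the energy balance is a sum of nonnegative terms with positive weights,
so all modes vanish. -/
theorem coeff_one_ne_zero {k : ℝ} (hk : Admissible k) {x : CircleFun} (hs : star x = x)
    (h0 : coeff 0 x = 0) (hx : x ≠ 0)
    (h : HasSum (fun n : ℤ => (n : ℝ) ^ 2 * (k ^ 2 * n ^ 2 - 1) * ‖coeff n x‖ ^ 2) 0) :
    coeff 1 x ≠ 0 := by
  intro h1
  have hm1 : coeff (-1) x = 0 := by rw [coeff_neg_of_star_eq hs, h1, map_zero]
  have hcases : ∀ n : ℤ, 2 ≤ |n| ∨ coeff n x = 0 := fun n => by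
    by_cases hn : 2 ≤ |n|
    · exact .inl hn
    · have : n = 0 ∨ n = 1 ∨ n = -1 := by rcases abs_cases n with h | h <;> omega
      rcases this with rfl | rfl | rfl
      exacts [.inr h0, .inr h1, .inr hm1]
  have hpos : ∀ n : ℤ, 2 ≤ |n| → 0 < (n : ℝ) ^ 2 * (k ^ 2 * n ^ 2 - 1) := fun n hn => by
    have h4 := four_le_sq_of_two_le_abs hn
    have : 0 < k ^ 2 * (n : ℝ) ^ 2 - 1 := by nlinarith [hk.half_le_sq]
    positivity
  have hz := (hasSum_zero_iff_of_nonneg fun n => by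
    rcases hcases n with hn | hn
    · exact mul_nonneg (hpos n hn).le (sq_nonneg _)
    · rw [hn]; simp).mp h
  refine hx (circleFun_ext fun n => ?_)
  rw [map_zero]
  rcases hcases n with hn | hn
  · have := (mul_eq_zero.mp (congrFun hz n)).resolve_left (hpos n hn).ne'
    simpa using this
  · exact hn

/-- Translation by `s` multiplies the first coefficient by `e^{is}`, so `s = -arg` makes it
positive. -/
theorem _root_.IsWaveTrain.exists_normalized {δ k M c q : ℝ} {V : ℝ → ℝ} (hδ : 0 < δ) (hk : Admissible k)
    (h : IsWaveTrain δ k M c q V) :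
    ∃ (s A : ℝ) (x : CircleFun), (∀ y : ℝ, x y = ((V (y + s) - M : ℝ) : ℂ)) ∧
      NormalizedSolution δ k (6 * M - c) A x := by
  obtain ⟨F, hF, hmodes, henergy⟩ := h.exists_solvesModes hδ hk.pos
  have hne : F ≠ 0 := by
    rintro rfl
    obtain ⟨x, y, hxy⟩ := h.nonconstant
    have e : ∀ y, V y = M := fun y => by
      have : ((V y - M : ℝ) : ℂ) = 0 := (hF y).symm
      exact sub_eq_zero.mp (by exact_mod_cast this)
    exact hxy ((e x).trans (e y).symm)
  have h1 := coeff_one_ne_zero hk hmodes.star_eq hmodes.coeff_zero hne henergy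
  obtain ⟨G, hG, hmodes', henergy'⟩ :=
    (h.translate (-Complex.arg (coeff 1 F))).exists_solvesModes hδ hk.pos
  refine ⟨-Complex.arg (coeff 1 F), ‖coeff 1 F‖, G, hG, hmodes', norm_pos_iff.mpr h1, ?_, henergy'⟩
  rw [coeff_translate (F := F) (s := -Complex.arg (coeff 1 F)) (fun y => by rw [hG, hF])]
  nth_rewrite 2 [← Complex.norm_mul_exp_arg_mul_I (coeff 1 F)]
  have hpi : (π : ℂ) ≠ 0 := by exact_mod_cast Real.pi_ne_zero
  rw [fourier_coe_apply, mul_left_comm, ← Complex.exp_add]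
  have : 2 * (π : ℂ) * I * ((1 : ℤ) : ℂ) * ((-Complex.arg (coeff 1 F) : ℝ) : ℂ) / ((2 * π : ℝ) : ℂ)
      + Complex.arg (coeff 1 F) * I = 0 := by
    push_cast; field_simp; ring
  rw [this, Complex.exp_zero, mul_one]

/-! ### Final estimates and the main theorem. -/

lemma region_mono {R R' : ℝ} (hR : 0 < R) (h : R ≤ R') : region R ⊆ region R' := fun _ hp =>
  ⟨(inv_anti₀ hR h).trans hp.1, hp.2.1.trans h, hp.2.2.1.trans h, hp.2.2.2⟩

lemma norm_profile_le {k R : ℝ} (hk : Admissible k) (hR : 0 < R) {p : ℝ × CircleFun}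
    (hp : p ∈ region R) :
    ‖profile (small k * √p.1) p.2‖ ≤ (2 * √R + R * R) * small k := by
  obtain ⟨h1, h2, h3, -⟩ := hp
  have hε := hk.small_pos
  have hp1 : 0 ≤ p.1 := (inv_pos.mpr hR).le.trans h1
  rw [profile]
  refine (norm_add_le _ _).trans ?_
  rw [norm_smul, norm_smul, Complex.norm_real, Complex.norm_real,
    Real.norm_of_nonneg (by positivity), Real.norm_of_nonneg (by positivity), mul_pow,
    Real.sq_sqrt hp1]
  have e1 : small k * √p.1 * ‖cosOne‖ ≤ small k * √R * 2 := by
    gcongr; exact norm_cosOne_le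
  have e2 : small k ^ 2 * p.1 * ‖p.2‖ ≤ small k * R * R := by
    gcongr
    exact pow_le_of_le_one hε.le hk.small_le_one two_ne_zero
  linarith

lemma abs_speedCorr_le {ε R : ℝ} (hε : 0 < ε) (hε1 : ε ≤ 1) (hR : 0 < R) {p : ℝ × CircleFun}
    (hp : p ∈ region R) :
    |speedCorr ε p.1 p.2| ≤ 6 * R * R + 3 * (√R * R) * R ^ 2 := by
  obtain ⟨h1, h2, h3, -⟩ := hp
  have hp1 : 0 ≤ p.1 := (inv_pos.mpr hR).le.trans h1
  rw [speedCorr, abs_neg, firstMode]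
  refine (Complex.abs_re_le_norm _).trans ((norm_add_le _ _).trans ?_)
  rw [norm_mul, norm_mul, Complex.norm_real, Complex.norm_real,
    Real.norm_of_nonneg (by positivity), Real.norm_of_nonneg (by positivity)]
  gcongr
  · exact (norm_coeff_le _ _).trans h3
  · linarith
  · exact (norm_coeff_le _ _).trans ((norm_mul_self_le _).trans (by gcongr))

end WaveTrain

open WaveTrain in
theorem mainTheorem1 (δ : ℝ) (hδ : 0 < δ) (M : ℝ) :
    ∃ k₀ C : ℝ, 0 < k₀ ∧ k₀ < 1 ∧ ∀ k : ℝ, k₀ < k → k < 1 →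
      ∃ (c q : ℝ) (U : ℝ → ℝ),
        IsWaveTrain δ k M c q U ∧
        (∀ (c' q' : ℝ) (V : ℝ → ℝ), IsWaveTrain δ k M c' q' V →
          c' = c ∧ q' = q ∧ ∃ s : ℝ, ∀ y, V y = U (y + s)) ∧
        (∀ y, |U y - M| ≤ C * √(1 - k)) ∧
        |c - (6 * M - 1)| ≤ C * (1 - k) ∧
        |q - (M - 3 * M ^ 2)| ≤ C * (1 - k) := by
  obtain ⟨R₀, hR₀, hfix⟩ := exists_unique_fixed hδ
  obtain ⟨R₁, hR₁, ε₁, hε₁, happ⟩ := exists_scaledModes hδ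
  set R := max R₀ R₁ with hRdef
  have hR : 0 < R := hR₀.trans_le (le_max_left _ _)
  obtain ⟨ε₀, hε₀, hfix⟩ := hfix R (le_max_left _ _)
  set ε₂ := min ε₀ ε₁ with hε₂def
  have hε₂ : 0 < ε₂ := lt_min hε₀ hε₁
  set D := 2 * √R + R * R with hD
  set B := 6 * R * R + 3 * (√R * R) * R ^ 2 with hB
  have hDpos : 0 < D := by positivity
  have hBpos : 0 < B := by positivity
  -- The bound `3/4` gives `k² ≥ 1/2`; the other gives `ε² ≤ 2(1 - k) < ε₂²`. The constant `C` sums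
  -- those of the three estimates.
  refine ⟨max (3 / 4) (1 - ε₂ ^ 2 / 2),
    2 * D + 2 * (1 + B) + (|M - 3 * M ^ 2| + 2 * (1 + B) * |M| + 6 * D ^ 2),
    lt_max_of_lt_left (by norm_num), max_lt (by norm_num) ?_, fun k hk0 hk1 => ?_⟩
  · have : 0 < ε₂ ^ 2 := by positivity
    linarith
  obtain ⟨hk34, hkε⟩ := max_lt_iff.mp hk0
  have hk : Admissible k := ⟨by linarith, by nlinarith, hk1⟩
  have hε := hk.small_pos
  have hεsq : small k ^ 2 ≤ 2 * (1 - k) := by rw [hk.small_sq]; nlinarith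
  have hsmall : small k < ε₂ := by
    refine lt_of_pow_lt_pow_left₀ 2 hε₂.le ?_
    linarith
  obtain ⟨p, hp, hpfix, hpuniq⟩ := hfix k hk (hsmall.trans_le (min_le_left _ _))
  have hp1 : 0 < p.1 := (inv_pos.mpr hR).trans_le hp.1
  have hscaled := scaledModes_of_fixed hδ hk hp.2.2.2 hpfix
  set b := speedCorr (small k) p.1 p.2 with hb
  set x := profile (small k * √p.1) p.2 with hx
  have hmodes := (solvesModes_profile_iff hk hp1 hp.2.2.2 hscaled.low).mpr hscaled
  have hx1 : coeff 1 x ≠ 0 := by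
    rw [hx, profile, map_add, map_smul, map_smul, hscaled.low 1 (by norm_num), coeff_cosOne]
    have : (√p.1 : ℂ) ≠ 0 := by exact_mod_cast (Real.sqrt_pos.mpr hp1).ne'
    have : (small k : ℂ) ≠ 0 := by exact_mod_cast hε.ne'
    norm_num
    tauto
  have hwave := hmodes.isWaveTrain M hδ hk.pos hk.half_le_sq hx1
  set a := k ^ 2 + small k ^ 2 * b with ha
  have hxn := norm_profile_le hk hR hp
  have hbn : |b| ≤ B := abs_speedCorr_le hε hk.small_le_one hR hp
  have hc : |6 * M - a - (6 * M - 1)| ≤ 2 * (1 + B) * (1 - k) := by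
    have e : 6 * M - a - (6 * M - 1) = small k ^ 2 * (1 - b) := by
      rw [ha]; linear_combination -hk.small_sq
    rw [e, abs_mul, abs_of_nonneg (sq_nonneg _)]
    calc _ ≤ 2 * (1 - k) * (1 + B) := by
          gcongr
          exact (abs_sub _ _).trans (by rw [abs_one]; linarith)
      _ = _ := by ring
  have h1k : 0 < 1 - k := by linarith
  have hM : 0 ≤ |M - 3 * M ^ 2| := abs_nonneg _
  have hM' : 0 ≤ |M| := abs_nonneg _
  refine ⟨_, _, _, hwave, fun c' q' V hV => ?_, fun y => ?_, ?_, ?_⟩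
  · obtain ⟨s, A, x', hx', hnorm⟩ := hV.exists_normalized hδ hk
    obtain ⟨b', β, z, hreg, hsc, ha', hxz⟩ := happ k hk (hsmall.trans_le (min_le_right _ _)) _ _ _
      hnorm
    obtain ⟨hb', hfix'⟩ := hsc.fixed hδ hk
    have hpz := hpuniq _ (region_mono hR₁ (le_max_right _ _) hreg) hfix'
    have hβ : β = p.1 := congrArg Prod.fst hpz
    have hz : z = p.2 := congrArg Prod.snd hpz
    subst hβ hz
    have hcc : c' = 6 * M - a := by rw [ha, hb, ← hb']; linarith
    have hVU : (fun y => V (y + s)) = fun y : ℝ => M + (x y).re := funext fun y => by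
      have := congrArg Complex.re (hx' y)
      rw [Complex.ofReal_re] at this
      rw [hx, ← hxz]
      linarith
    refine ⟨hcc, ?_, -s, fun y => ?_⟩
    -- The translate of `V` is `U` and the speeds agree, so the left sides coincide at one point and
    -- with them the integration constants.
    · have h1 := (hV.translate s).profile_eq 0
      have h2 : V (0 + s) = M + (x (0 : ℝ)).re := congrFun hVU 0
      simp only [hVU, h2, hcc] at h1
      exact h1.symm.trans (hwave.profile_eq 0)
    · have := congrFun hVU (y + -s)
      simpa using this
  · have e : |M + (x y).re - M| ≤ D * small k := by
      rw [add_sub_cancel_left]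
      exact (Complex.abs_re_le_norm _).trans ((x.norm_coe_le_norm _).trans hxn)
    have hs : small k ≤ 2 * √(1 - k) := by
      refine (pow_le_pow_iff_left₀ hε.le (by positivity) two_ne_zero).mp ?_
      rw [mul_pow, Real.sq_sqrt h1k.le]
      linarith
    refine e.trans ?_
    calc D * small k ≤ D * (2 * √(1 - k)) := by gcongr
      _ = 2 * D * √(1 - k) := by ring
      _ ≤ _ := by gcongr; nlinarith [mul_nonneg hBpos.le hM', sq_nonneg D]
  · refine hc.trans ?_
    gcongr
    nlinarith [mul_nonneg hBpos.le hM', sq_nonneg D]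
  · set e := 6 * M - a - (6 * M - 1) with he
    set r := (coeff 0 (x * x)).re with hr
    have hrn : |r| ≤ D ^ 2 * (2 * (1 - k)) := by
      refine (Complex.abs_re_le_norm _).trans ((norm_coeff_le _ _).trans
        ((norm_mul_self_le _).trans ?_))
      calc ‖x‖ ^ 2 ≤ (D * small k) ^ 2 := by gcongr
        _ = D ^ 2 * small k ^ 2 := by ring
        _ ≤ _ := by gcongr
    have e1 : k * (3 * M ^ 2 - (6 * M - a) * M) + 3 * k * r - (M - 3 * M ^ 2)
        = -((1 - k) * (M - 3 * M ^ 2)) + -(k * (e * M)) + k * (3 * r) := by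
      rw [he]; ring
    have hk0' := hk.pos
    rw [e1]
    calc _ ≤ (1 - k) * |M - 3 * M ^ 2| + 1 * (2 * (1 + B) * (1 - k) * |M|)
          + 1 * (3 * (D ^ 2 * (2 * (1 - k)))) := by
          refine (abs_add_three _ _ _).trans ?_
          rw [abs_neg, abs_neg, abs_mul, abs_mul, abs_mul, abs_mul, abs_mul, abs_of_pos h1k,
            abs_of_pos hk0', abs_of_pos (by norm_num : (0 : ℝ) < 3)]
          gcongr
      _ = (|M - 3 * M ^ 2| + 2 * (1 + B) * |M| + 6 * D ^ 2) * (1 - k) := by ring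
      _ ≤ _ := mul_le_mul_of_nonneg_right (by linarith) h1k.le
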